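/- Let $\mathcal{M}$ be a von Neumann algebra on a Hilbert space and $\psi$ a faithful normal state on $\mathcal{M}$ with GNS space $\mathcal{H}_\psi$ and vectors $|a\rangle=\pi_\psi(a)|1\rangle$. Let $S=J\Delta^{1/2}$ be the Tomita operator, i.e. the closure of $|a\rangle\mapsto|a^*\rangle$, and $\Delta=S^*S$ the modular operator. For $a,b\in\mathcal{M}$ and $t\in\mathbb{R}$ let $$f_{ab}(t)=\langle a|\,\Delta^{1/2+it}\,|b\rangle,\qquad f^{\rm conn}_{ab}(t)=f_{\mathbf a\mathbf b}(t),\quad \mathbf a=a-\psi(a)1,\ \mathbf b=b-\psi(b)1 .$$ A set $\mathcal{X}\subset\mathcal{M}$ is future (past) $\psi$-mixing if $f^{\rm conn}_{ab}(t)\to0$ as $t\to+\infty$ ($t\to-\infty$) for all $a,b\in\mathcal{X}$, and $\psi$-mixing if it is both. Let $\langle a,b\rangle$ denote either of the two inner products $\psi(a^*b)$ or $f_{ab}(0)$ on $\mathcal{M}$. For a set $\mathcal{X}$, let $\mathcal{S}^{\mathcal{X}}_\psi$ be the set of all $a\in\mathcal{M}$ of the form $a=\alpha_0 1+\sum_{O\in\mathcal{X}}\alpha_O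 O$ with $\alpha_0,\alpha_O\in\mathbb{C}$, where the (unordered) sum converges in the norm $\langle a,a\rangle^{1/2}$. An operator system is a norm-closed, $*$-closed linear subspace of $\mathcal{M}$ that contains $1$. **Lemma.** Let $\mathcal{X}\subset\mathcal{M}$ be a countable set of self-adjoint elements that are pairwise orthogonal with respect to $\langle\cdot,\cdot\rangle$. Suppose that $\mathcal{X}$ is future $\psi$-mixing or past $\psi$-mixing. Then $\mathcal{X}$ is $\psi$-mixing (in both the future and the past). Moreover, $\mathcal{S}^{\mathcal{X}}_\psi$ is an operator system that contains $\mathcal{X}$, and $\mathcal{S}^{\mathcal{X}}_\psi$ is $\psi$-mixing. (All correlators are well defined: $|a\rangle$ lies in the domain of $\Delta^{1/2+it}$ for all $a\in\mathcal{M}$, $t\in\mathbb{R}$.) -/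

import Mathlib

open Filter Topology
open scoped ComplexOrder InnerProductSpace ComplexInnerProductSpace

/-! ## A von Neumann algebra as a (Loewner-ordered) C⋆-algebra -/

section VonNeumann

variable {K : Type*} [NormedAddCommGroup K] [InnerProductSpace ℂ K] [CompleteSpace K]

instance VonNeumannAlgebra.instSMulMemClassComplex :
    SMulMemClass (VonNeumannAlgebra K) ℂ (K →L[ℂ] K) where
  smul_mem {s} c _ ha := s.toStarSubalgebra.smul_mem ha c

instance VonNeumannAlgebra.instIsClosedCoe (M : VonNeumannAlgebra K) :
    IsClosed (M : Set (K →L[ℂ] K)) := by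
  rw [← M.centralizer_centralizer]
  exact Set.isClosed_centralizer _

/-- The order that a von Neumann algebra inherits from the Loewner order of the bounded operators
is the order whose positive cone is generated by the elements `star s * s` of the algebra. -/
instance VonNeumannAlgebra.instStarOrderedRing (M : VonNeumannAlgebra K) :
    StarOrderedRing M := by
  refine StarOrderedRing.of_nonneg_iff' (fun {a b} hab c => ?_) (fun a => ⟨fun ha => ?_, ?_⟩)
  · exact add_le_add_right (α := K →L[ℂ] K) hab c
  · obtain ⟨a, haM⟩ := a
    have ha' : (0 : K →L[ℂ] K) ≤ a := ha
    have : IsClosed (M.toStarSubalgebra : Set (K →L[ℂ] K)) := M.instIsClosedCoe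
    let b : M.toStarSubalgebra := ⟨a, haM⟩
    have hb : IsSelfAdjoint b := Subtype.ext (IsSelfAdjoint.of_nonneg ha').star_eq
    have hb' : SpectrumRestricts b ContinuousMap.realToNNReal := by
      rw [SpectrumRestricts.nnreal_iff]
      intro r hr
      rw [← spectrum.preimage_algebraMap ℂ, Set.mem_preimage, StarSubalgebra.spectrum_eq,
        ← Set.mem_preimage, spectrum.preimage_algebraMap ℂ] at hr
      exact spectrum_nonneg_of_nonneg ha' hr
    obtain ⟨s, hs, -, hs'⟩ := CFC.exists_sqrt_of_isSelfAdjoint_of_quasispectrumRestricts hb hb'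
    refine ⟨⟨s, s.2⟩, Subtype.ext ?_⟩
    have h1 : star (s : K →L[ℂ] K) = s := congrArg Subtype.val hs.star_eq
    have h2 : (s : K →L[ℂ] K) * s = a := congrArg Subtype.val hs'
    change a = star (s : K →L[ℂ] K) * s
    rw [h1, h2]
  · rintro ⟨s, rfl⟩
    exact star_mul_self_nonneg (s : K →L[ℂ] K)

end VonNeumann

namespace ModularMixing

section Modular

variable {A : Type*} [CStarAlgebra A] [PartialOrder A] [StarOrderedRing A] (ψ : A →ₚ[ℂ] ℂ)

/-- The vector `|a⟩ = π(a)|1⟩` of the GNS Hilbert space of `ψ`. -/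
noncomputable def ket : A →ₗ[ℂ] ψ.GNS where
  toFun a := (ψ.toPreGNS a : ψ.GNS)
  map_add' a b := by rw [map_add, UniformSpace.Completion.coe_add]
  map_smul' c a := by rw [map_smul, UniformSpace.Completion.coe_smul]; rfl

theorem inner_ket (a b : A) : ⟪ket ψ a, ket ψ b⟫_ℂ = ψ (star a * b) := by
  change ⟪(ψ.toPreGNS a : ψ.GNS), (ψ.toPreGNS b : ψ.GNS)⟫_ℂ = _
  rw [UniformSpace.Completion.inner_coe, PositiveLinearMap.preGNS_inner_def]
  simp

theorem dense_ket : DenseRange (ket ψ) :=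
  (UniformSpace.Completion.denseRange_coe (α := ψ.PreGNS)).comp
    ψ.toPreGNS.surjective.denseRange (UniformSpace.Completion.continuous_coe ψ.PreGNS)

/-- The graph of the Tomita operator `S`, i.e. of the closure of the antilinear operator
`|a⟩ ↦ |a⋆⟩`. -/
def tomitaGraph : Set (ψ.GNS × ψ.GNS) :=
  closure (Set.range fun a : A => (ket ψ a, ket ψ (star a)))

/-- `(y, z)` is in the graph of the (antilinear) adjoint `S⋆` of the Tomita operator:
`⟪S v, y⟫ = ⟪z, v⟫` for all `v` in the core of `S` formed by the vectors `|a⟩`. -/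
def IsTomitaAdjoint (y z : ψ.GNS) : Prop :=
  ∀ a : A, ⟪ket ψ (star a), y⟫_ℂ = ⟪z, ket ψ a⟫_ℂ

variable {ψ} in
theorem tomitaGraph_add {p q : ψ.GNS × ψ.GNS} (hp : p ∈ tomitaGraph ψ)
    (hq : q ∈ tomitaGraph ψ) : p + q ∈ tomitaGraph ψ := by
  refine map_mem_closure₂ continuous_add hp hq ?_
  rintro _ ⟨a, rfl⟩ _ ⟨b, rfl⟩
  exact ⟨a + b, by simp⟩

variable {ψ} in
theorem tomitaGraph_smul (c : ℂ) {p : ψ.GNS × ψ.GNS} (hp : p ∈ tomitaGraph ψ) :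
    (c • p.1, starRingEnd ℂ c • p.2) ∈ tomitaGraph ψ := by
  have hc : Continuous fun p : ψ.GNS × ψ.GNS => (c • p.1, starRingEnd ℂ c • p.2) :=
    (continuous_fst.const_smul c).prodMk (continuous_snd.const_smul (starRingEnd ℂ c))
  refine map_mem_closure (f := fun p : ψ.GNS × ψ.GNS => (c • p.1, starRingEnd ℂ c • p.2))
    hc hp ?_
  rintro _ ⟨a, rfl⟩
  refine ⟨c • a, Prod.ext (map_smul (ket ψ) c a) ?_⟩
  change ket ψ (star (c • a)) = _
  rw [star_smul, map_smul]
  rfl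

/-- The graph of the modular operator `Δ = S⋆ S`. -/
def modularGraph : Submodule ℂ (ψ.GNS × ψ.GNS) where
  carrier := {p | ∃ y, (p.1, y) ∈ tomitaGraph ψ ∧ IsTomitaAdjoint ψ y p.2}
  zero_mem' := ⟨0, subset_closure ⟨0, by simp⟩, fun a => by simp⟩
  add_mem' := by
    rintro p q ⟨y, hy, hy'⟩ ⟨z, hz, hz'⟩
    refine ⟨y + z, tomitaGraph_add hy hz, fun a => ?_⟩
    rw [inner_add_right, hy' a, hz' a, Prod.snd_add, inner_add_left]
  smul_mem' := by
    rintro c p ⟨y, hy, hy'⟩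
    refine ⟨starRingEnd ℂ c • y, tomitaGraph_smul c hy, fun a => ?_⟩
    rw [inner_smul_right, hy' a, Prod.smul_snd, inner_smul_left]

/-- The modular operator `Δ = S⋆ S`, a partially defined operator on the GNS space. -/
noncomputable def modularOperator : ψ.GNS →ₗ.[ℂ] ψ.GNS :=
  (modularGraph ψ).toLinearPMap

variable {ψ} in
theorem IsTomitaAdjoint.inner_eq {y z u v : ψ.GNS} (h : IsTomitaAdjoint ψ y z)
    (huv : (u, v) ∈ tomitaGraph ψ) : ⟪v, y⟫_ℂ = ⟪z, u⟫_ℂ := by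
  have hcl : IsClosed {p : ψ.GNS × ψ.GNS | ⟪p.2, y⟫_ℂ = ⟪z, p.1⟫_ℂ} :=
    isClosed_eq (by fun_prop) (by fun_prop)
  refine closure_minimal ?_ hcl huv
  rintro _ ⟨a, rfl⟩
  exact h a

/-- `1 + Δ` is onto. -/
theorem exists_modularGraph (x : ψ.GNS) : ∃ u, (u, x - u) ∈ modularGraph ψ := by
  let : InnerProductSpace ℝ ψ.GNS := InnerProductSpace.rclikeToReal ℂ ψ.GNS
  have hre : ∀ v w : ψ.GNS, ⟪v, w⟫_ℝ = (⟪v, w⟫_ℂ).re := fun v w => rfl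
  let V : Submodule ℝ (WithLp 2 (ψ.GNS × ψ.GNS)) :=
    { carrier := {p | (p.fst, p.snd) ∈ tomitaGraph ψ}
      zero_mem' := subset_closure ⟨0, by simp⟩
      add_mem' := fun hp hq => tomitaGraph_add hp hq
      smul_mem' := fun c p hp => by
        have := tomitaGraph_smul (c : ℂ) hp
        simpa using this }
  have hV : IsClosed (V : Set (WithLp 2 (ψ.GNS × ψ.GNS))) :=
    isClosed_closure.preimage (by fun_prop :
      Continuous fun p : WithLp 2 (ψ.GNS × ψ.GNS) => (p.fst, p.snd))
  have : CompleteSpace V := hV.completeSpace_coe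
  let v := V.starProjection (WithLp.toLp 2 (x, 0))
  have hv : (v.fst, v.snd) ∈ tomitaGraph ψ :=
    V.starProjection_apply_mem (WithLp.toLp 2 (x, 0))
  have horth : ∀ a : A, (⟪ket ψ (star a), v.snd⟫_ℂ).re = (⟪x - v.fst, ket ψ a⟫_ℂ).re := by
    intro a
    have h := V.starProjection_inner_eq_zero (WithLp.toLp 2 (x, 0))
      (WithLp.toLp 2 (ket ψ a, ket ψ (star a))) (subset_closure ⟨a, rfl⟩)
    rw [WithLp.prod_inner_apply] at h
    change (⟪x - v.fst, ket ψ a⟫_ℂ).re + (⟪0 - v.snd, ket ψ (star a)⟫_ℂ).re = 0 at h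
    rw [zero_sub, inner_neg_left, Complex.neg_re] at h
    have h' : (⟪ket ψ (star a), v.snd⟫_ℂ).re = (⟪v.snd, ket ψ (star a)⟫_ℂ).re :=
      inner_re_symm (𝕜 := ℂ) _ _
    linarith
  refine ⟨v.fst, v.snd, hv, fun a => Complex.ext (horth a) ?_⟩
  have h := horth (Complex.I • a)
  rw [star_smul, map_smul, map_smul, inner_smul_left, inner_smul_right] at h
  simpa using h

variable {ψ} in
theorem norm_le_of_mem_modularGraph {x u : ψ.GNS} (h : (u, x - u) ∈ modularGraph ψ) :
    ‖u‖ ≤ ‖x‖ := by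
  obtain ⟨y, hy, hy'⟩ := h
  have h1 := hy'.inner_eq hy
  simp only [inner_sub_left] at h1
  have h2 : ‖y‖ ^ 2 + ‖u‖ ^ 2 = RCLike.re ⟪x, u⟫_ℂ := by
    have := congrArg RCLike.re h1
    simp only [map_sub, inner_self_eq_norm_sq] at this
    linarith
  have h3 := (RCLike.re_le_norm _).trans (norm_inner_le_norm (𝕜 := ℂ) x u)
  by_contra! hlt
  nlinarith [norm_nonneg u, norm_nonneg x, sq_nonneg ‖y‖]

theorem existsUnique_modularGraph (x : ψ.GNS) : ∃! u, (u, x - u) ∈ modularGraph ψ := by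
  obtain ⟨u, hu⟩ := exists_modularGraph ψ x
  refine ⟨u, hu, fun v hv => ?_⟩
  have h : (v - u, (0 : ψ.GNS) - (v - u)) ∈ modularGraph ψ := by
    have := (modularGraph ψ).sub_mem hv hu
    simpa using this
  have := norm_le_of_mem_modularGraph h
  rwa [norm_zero, norm_le_zero_iff, sub_eq_zero] at this

/-- The bounded operator `(1 + Δ)⁻¹`: it maps `x` to the unique `u` in the domain of `Δ` with
`u + Δ u = x`. -/
noncomputable def modularResolvent : ψ.GNS →L[ℂ] ψ.GNS :=
  LinearMap.mkContinuous
    { toFun := fun x => (existsUnique_modularGraph ψ x).choose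
      map_add' := fun x y => by
        refine (existsUnique_modularGraph ψ (x + y)).unique
          (existsUnique_modularGraph ψ (x + y)).choose_spec.1 ?_
        have := (modularGraph ψ).add_mem (existsUnique_modularGraph ψ x).choose_spec.1
          (existsUnique_modularGraph ψ y).choose_spec.1
        rwa [Prod.mk_add_mk, sub_add_sub_comm] at this
      map_smul' := fun c x => by
        refine (existsUnique_modularGraph ψ (c • x)).unique
          (existsUnique_modularGraph ψ (c • x)).choose_spec.1 ?_
        have := (modularGraph ψ).smul_mem c (existsUnique_modularGraph ψ x).choose_spec.1
        rwa [Prod.smul_mk, smul_sub] at this }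
    1 (fun x => by
      rw [one_mul]
      exact norm_le_of_mem_modularGraph (existsUnique_modularGraph ψ x).choose_spec.1)

theorem modularResolvent_mem (x : ψ.GNS) :
    (modularResolvent ψ x, x - modularResolvent ψ x) ∈ modularGraph ψ :=
  (existsUnique_modularGraph ψ x).choose_spec.1

theorem modularResolvent_injective {x : ψ.GNS} (hx : modularResolvent ψ x = 0) : x = 0 := by
  have h := modularResolvent_mem ψ x
  rw [hx, sub_zero] at h
  obtain ⟨y, hy, hy'⟩ := h
  have h0 : y = 0 := by
    have := hy'.inner_eq hy
    rwa [inner_zero_right, inner_self_eq_zero] at this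
  subst h0
  refine (dense_ket ψ).eq_zero_of_inner_left (𝕜 := ℂ) ?_
  intro a
  rw [← hy' a, inner_zero_right]

theorem modularResolvent_isSelfAdjoint : IsSelfAdjoint (modularResolvent ψ) := by
  rw [ContinuousLinearMap.isSelfAdjoint_iff_isSymmetric]
  intro x x'
  obtain ⟨y, hy, hy'⟩ := modularResolvent_mem ψ x
  obtain ⟨z, hz, hz'⟩ := modularResolvent_mem ψ x'
  have h1 := hy'.inner_eq hz
  have h2 := hz'.inner_eq hy
  simp only [inner_sub_left] at h1 h2
  have h3 := congrArg (starRingEnd ℂ) h2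
  simp only [map_sub, inner_conj_symm] at h3
  change ⟪modularResolvent ψ x, x'⟫_ℂ = ⟪x, modularResolvent ψ x'⟫_ℂ
  linear_combination h1 - h3

/-- The bounded operator `Δ ^ z (1 + Δ)⁻¹` for `0 < re z < 1`. In terms of the spectral variable
`l = 1 / (1 + d)` of `(1 + Δ)⁻¹`, where `d` is that of `Δ`, the function `d ^ z / (1 + d)` reads
`(1 - l) ^ z * l ^ (1 - z)`; it is continuous on `[0, 1]`. -/
noncomputable def modularPowResolvent (z : ℂ) : ψ.GNS →L[ℂ] ψ.GNS :=
  cfc (fun l : ℂ => (1 - l) ^ z * l ^ (1 - z)) (modularResolvent ψ)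

/-- The operator `Δ ^ z` for `0 < re z < 1`. Its domain consists of the `x` such that
`Δ ^ z (1 + Δ)⁻¹ x` lies in the range of `(1 + Δ)⁻¹`, and `Δ ^ z x` is the unique `y` with
`(1 + Δ)⁻¹ y = Δ ^ z (1 + Δ)⁻¹ x`. -/
noncomputable def modularPow (z : ℂ) : ψ.GNS →ₗ.[ℂ] ψ.GNS :=
  (LinearMap.ker ((modularPowResolvent ψ z).toLinearMap ∘ₗ LinearMap.fst ℂ ψ.GNS ψ.GNS -
    (modularResolvent ψ).toLinearMap ∘ₗ LinearMap.snd ℂ ψ.GNS ψ.GNS)).toLinearPMap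

theorem mem_graph_modularPow (z : ℂ) (x y : ψ.GNS) :
    (x, y) ∈ (modularPow ψ z).graph ↔ modularResolvent ψ y = modularPowResolvent ψ z x := by
  rw [modularPow, Submodule.toLinearPMap_graph_eq]
  · rw [LinearMap.mem_ker]
    simp only [LinearMap.sub_apply, LinearMap.comp_apply, sub_eq_zero]
    exact eq_comm
  · rintro ⟨u, v⟩ huv hu
    simp only at hu
    subst hu
    refine modularResolvent_injective ψ ?_
    simpa [sub_eq_zero, eq_comm] using huv

open Classical in
/-- The modular correlator `f_ab(t) = ⟨1| a⋆ Δ ^ (1/2 + i t) b |1⟩` (the value `0` off the domain is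
never used for a faithful normal state). -/
noncomputable def modularCorrelator (a b : A) (t : ℝ) : ℂ :=
  if h : ket ψ b ∈ (modularPow ψ (1 / 2 + t * Complex.I)).domain then
    ⟪ket ψ a, modularPow ψ (1 / 2 + t * Complex.I) ⟨ket ψ b, h⟩⟫_ℂ
  else 0

/-- The connected correlator, i.e. the correlator of `a - ψ(a)` and `b - ψ(b)`. -/
noncomputable def connectedCorrelator (a b : A) (t : ℝ) : ℂ :=
  modularCorrelator ψ (a - ψ a • 1) (b - ψ b • 1) t

/-- Future mixing: the connected correlators decay as `t → ∞`. -/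
def IsFutureMixing (X : Set A) : Prop :=
  ∀ a ∈ X, ∀ b ∈ X, Tendsto (connectedCorrelator ψ a b) atTop (𝓝 0)

/-- Past mixing: the connected correlators decay as `t → -∞`. -/
def IsPastMixing (X : Set A) : Prop :=
  ∀ a ∈ X, ∀ b ∈ X, Tendsto (connectedCorrelator ψ a b) atBot (𝓝 0)

/-- Mixing: the connected correlators decay both in the future and in the past. -/
def IsMixing (X : Set A) : Prop := IsFutureMixing ψ X ∧ IsPastMixing ψ X

/-- The GNS inner product `ψ(a⋆ b)`. -/
noncomputable def gnsInner (a b : A) : ℂ := ψ (star a * b)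

/-- The alternate inner product `f_ab(0) = ⟨1| a⋆ Δ ^ (1/2) b |1⟩`. -/
noncomputable def alternateInner (a b : A) : ℂ := modularCorrelator ψ a b 0

end Modular

section OperatorSystem

variable {A : Type*} [CStarAlgebra A]

/-- The operator system generated by `X`: all `a = α₀ + ∑ α_O O`, the sum over `O ∈ X` being
convergent in the (Hilbert space) norm of the inner product `ip`. -/
def generatedSystem (ip : A → A → ℂ) (X : Set A) : Set A :=
  {a | ∃ (α₀ : ℂ) (α : X → ℂ), Tendsto (fun F : Finset X =>
    ip (a - (α₀ • (1 : A) + ∑ O ∈ F, α O • (O : A)))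
      (a - (α₀ • (1 : A) + ∑ O ∈ F, α O • (O : A)))) atTop (𝓝 0)}

/-- Operator systems: norm-closed, `⋆`-closed linear subspaces that contain the identity. -/
def IsOperatorSystem (S : Set A) : Prop :=
  (∃ V : Submodule ℂ A, (V : Set A) = S) ∧ 1 ∈ S ∧ (∀ a ∈ S, star a ∈ S) ∧ IsClosed S

end OperatorSystem

section States

variable {K : Type*} [NormedAddCommGroup K] [InnerProductSpace ℂ K] [CompleteSpace K]
  {M : VonNeumannAlgebra K}

/-- A normal functional is given by a density matrix `ρ = ∑ |ξ n⟩⟨ξ n|`. -/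
def IsNormal (ψ : M →ₚ[ℂ] ℂ) : Prop :=
  ∃ ξ : ℕ → K, ∀ a : M, HasSum (fun n => ⟪ξ n, (a : K →L[ℂ] K) (ξ n)⟫_ℂ) (ψ a)

/-- Faithfulness: `ψ(a⋆ a) = 0` only for `a = 0`. -/
def IsFaithful (ψ : M →ₚ[ℂ] ℂ) : Prop := ∀ a : M, ψ (star a * a) = 0 → a = 0

end States

end ModularMixing

/-! Future and past mixing coincide because `Δ` is self-adjoint: taking adjoints gives `f_ab(-t) =
conj f_ba(t)`, and a mixing set contains both `a` and `b` (`modularCorrelator_neg`,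
`isFutureMixing_iff_isPastMixing`).

For the generated system, realise the inner product as `⟪L a, L b⟫` with `L a = |a⟩` or `L a = Δ ^
(1/4) |a⟩`. Orthogonality of `X` identifies membership with `L a` lying in the closed span of `L ''
X` plus the line of `L 1`, so the system is a norm-closed subspace. It is `⋆`-closed because
conjugating the coefficients of an orthogonal expansion preserves convergence, and closability of `L
a ↦ L (star a)` forces the new sum to be the expansion of `star a`. For `|a⟩` closability is that of
the Tomita operator, proved with the commutant (`tomitaGraph_closable`); for `Δ ^ (1/4) |a⟩` the
involution is even isometric (`norm_alternateKet_star`).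

Mixing passes from `X` to the system because the connected correlators are bounded, uniformly in
`t`, by the norm of `L` in either argument. An expansion is thus approximated by finite sums, in one
argument and then in the other (`isMixing_generatedSystem`).

The unbounded `Δ` is handled through `R = (1 + Δ)⁻¹`, whose spectrum lies in `[0, 1]`. The vectors
`|a⟩` have the form `R ^ (1/2) v`, which turns every correlator into a matrix element of a bounded
function `(1 - l) ^ z * l ^ w` of `R`. -/

namespace ModularMixing

/-! ### Expansions in orthogonal, not necessarily normalised, vectors. -/

section HilbertSums

variable {H : Type*} [NormedAddCommGroup H] [InnerProductSpace ℂ H]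

/-- The lines spanned by pairwise orthogonal vectors form an orthogonal family. -/
theorem orthogonalFamily_span_singleton {ι : Type*} {e : ι → H}
    (he : Pairwise fun i j => ⟪e i, e j⟫_ℂ = 0) :
    OrthogonalFamily ℂ (fun i => (ℂ ∙ e i : Submodule ℂ H)) fun i => (ℂ ∙ e i).subtypeₗᵢ := by
  rintro i j hij ⟨x, hx⟩ ⟨y, hy⟩
  obtain ⟨c, rfl⟩ := Submodule.mem_span_singleton.mp hx
  obtain ⟨d, rfl⟩ := Submodule.mem_span_singleton.mp hy
  simp [inner_smul_left, inner_smul_right, he hij]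

variable [CompleteSpace H]

/-- The closed span of pairwise orthogonal vectors consists of the sums of the convergent
expansions in these vectors. -/
theorem mem_topologicalClosure_span_iff_hasSum {ι : Type*} {e : ι → H}
    (he : Pairwise fun i j => ⟪e i, e j⟫_ℂ = 0) (w : H) :
    w ∈ (Submodule.span ℂ (Set.range e)).topologicalClosure ↔
      ∃ α : ι → ℂ, HasSum (fun i => α i • e i) w := by
  constructor
  · intro hw
    have hV := orthogonalFamily_span_singleton he
    -- The `ℓ²` sum of the lines embeds isometrically onto their closed span. Working with lines
    -- instead of unit vectors allows `e i = 0`.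
    have hr := hV.range_linearIsometry
    rw [Submodule.span_range_eq_iSup] at hw
    simp only [Submodule.subtypeₗᵢ_toLinearMap, Submodule.range_subtype] at hr
    rw [← hr] at hw
    obtain ⟨f, rfl⟩ := hw
    choose α hα using fun i => Submodule.mem_span_singleton.mp (f i).2
    refine ⟨α, ?_⟩
    simp only [hα]
    exact hV.hasSum_linearIsometry f
  · rintro ⟨α, hα⟩
    refine mem_closure_of_tendsto hα (Eventually.of_forall fun F => ?_)
    exact Submodule.sum_mem _ fun i _ =>
      Submodule.smul_mem _ _ (Submodule.subset_span (Set.mem_range_self i))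

/-- The convergence of an expansion in pairwise orthogonal vectors depends only on the absolute
values of the coefficients. -/
theorem summable_smul_of_norm_eq {ι : Type*} {e : ι → H}
    (he : Pairwise fun i j => ⟪e i, e j⟫_ℂ = 0) {α β : ι → ℂ} (hαβ : ∀ i, ‖α i‖ = ‖β i‖)
    (hα : Summable fun i => α i • e i) : Summable fun i => β i • e i := by
  have hV := orthogonalFamily_span_singleton he
  have key : ∀ γ : ι → ℂ, (Summable fun i => γ i • e i) ↔ Summable fun i => ‖γ i • e i‖ ^ 2 :=
    fun γ => hV.summable_iff_norm_sq_summable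
      fun i => ⟨γ i • e i, Submodule.smul_mem _ _ (Submodule.mem_span_singleton_self _)⟩
  rw [key] at hα ⊢
  simpa only [norm_smul, hαβ] using hα

end HilbertSums

/-! ### Generated systems for an inner product induced by a linear map into a Hilbert space. -/

section GeneratedSystem

variable {A : Type*} [CStarAlgebra A] {H : Type*} [NormedAddCommGroup H] [InnerProductSpace ℂ H]
  {L : A →ₗ[ℂ] H} {ip : A → A → ℂ} {X : Set A}

theorem mem_generatedSystem_iff_hasSum (hip : ∀ a b, ip a b = ⟪L a, L b⟫_ℂ) (a : A) :
    a ∈ generatedSystem ip X ↔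
      ∃ (α₀ : ℂ) (α : X → ℂ), HasSum (fun O : X => α O • L O) (L a - α₀ • L 1) := by
  refine exists_congr fun α₀ => exists_congr fun α => ?_
  have hsum : HasSum (fun O : X => α O • L O) (L a - α₀ • L 1) ↔ Tendsto
      (fun F : Finset X => ‖∑ O ∈ F, α O • L O - (L a - α₀ • L 1)‖) atTop (𝓝 0) := by
    rw [HasSum, SummationFilter.unconditional_filter, tendsto_iff_norm_sub_tendsto_zero]
  rw [hsum, tendsto_zero_iff_norm_tendsto_zero]
  have h : ∀ F : Finset X, ‖ip (a - (α₀ • (1 : A) + ∑ O ∈ F, α O • (O : A)))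
      (a - (α₀ • (1 : A) + ∑ O ∈ F, α O • (O : A)))‖ =
      ‖∑ O ∈ F, α O • L O - (L a - α₀ • L 1)‖ ^ 2 := by
    intro F
    rw [hip, inner_self_eq_norm_sq_to_K, ← norm_neg (L _)]
    simp only [map_sub, map_add, map_sum, map_smul]
    rw [show -(L a - (α₀ • L 1 + ∑ O ∈ F, α O • L O)) =
      ∑ O ∈ F, α O • L O - (L a - α₀ • L 1) by abel]
    simp
  simp only [h]
  constructor
  · intro h
    simpa [Real.sqrt_sq] using h.sqrt
  · intro h
    simpa using h.pow 2

/-- If a family of uniformly bounded functionals that vanish at `1` decays on `X`, then it decays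
on the system generated by `X`. -/
theorem tendsto_of_mem_generatedSystem (hip : ∀ a b, ip a b = ⟪L a, L b⟫_ℂ)
    {T : Type*} {l : Filter T} (g : T → A →ₗ[ℂ] ℂ) (C : ℝ) (hg : ∀ t a, ‖g t a‖ ≤ C * ‖L a‖)
    (hg1 : ∀ t, g t 1 = 0) (hgX : ∀ a ∈ X, Tendsto (fun t => g t a) l (𝓝 0)) {a : A}
    (ha : a ∈ generatedSystem ip X) : Tendsto (fun t => g t a) l (𝓝 0) := by
  rw [mem_generatedSystem_iff_hasSum hip] at ha
  obtain ⟨α₀, α, hα⟩ := ha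
  let s : Finset X → A := fun F => α₀ • (1 : A) + ∑ O ∈ F, α O • (O : A)
  have hs : Tendsto (fun F => C * ‖L (a - s F)‖) atTop (𝓝 0) := by
    have h := ((hα.const_sub (L a - α₀ • L 1)).norm).const_mul C
    simp only [sub_self, norm_zero, mul_zero] at h
    refine h.congr fun F => ?_
    simp [s, sub_sub]
  have hsF : ∀ F, Tendsto (fun t => g t (s F)) l (𝓝 0) := by
    intro F
    simp only [s, map_add, map_sum, map_smul, hg1, smul_zero, zero_add]
    rw [← Finset.sum_const_zero (s := F)]
    refine tendsto_finsetSum F fun O _ => ?_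
    simpa using (hgX O O.2).const_smul (α O)
  rw [Metric.tendsto_nhds]
  intro ε hε
  -- `F` can be fixed before `t`, since the error bound `C * ‖L (a - s F)‖` does not depend on `t`.
  obtain ⟨F, hF⟩ := (hs.eventually_lt_const (half_pos hε)).exists
  filter_upwards [Metric.tendsto_nhds.mp (hsF F) _ (half_pos hε)] with t ht
  rw [dist_zero_right] at ht ⊢
  have h1 := hg t (a - s F)
  have h2 := norm_add_le (g t (a - s F)) (g t (s F))
  rw [← map_add, sub_add_cancel] at h2
  linarith

variable [CompleteSpace H]

/-- This makes linearity and closedness visible: orthogonality ensures that every vector of the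
closed span has a convergent expansion, so the coefficients need not be tracked. -/
theorem generatedSystem_eq_preimage (hip : ∀ a b, ip a b = ⟪L a, L b⟫_ℂ)
    (horth : X.Pairwise fun a b => ip a b = 0) :
    generatedSystem ip X =
      (((Submodule.span ℂ (L '' X)).topologicalClosure ⊔ ℂ ∙ L 1).comap L : Set A) := by
  have he : Pairwise fun O P : X => ⟪L O, L P⟫_ℂ = 0 := fun O P hOP => by
    change ⟪L O, L P⟫_ℂ = 0
    rw [← hip]
    exact horth O.2 P.2 fun h => hOP (Subtype.ext h)
  ext a
  rw [mem_generatedSystem_iff_hasSum hip, SetLike.mem_coe, Submodule.mem_comap,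
    Submodule.mem_sup, Set.image_eq_range]
  constructor
  · rintro ⟨α₀, α, h⟩
    exact ⟨_, (mem_topologicalClosure_span_iff_hasSum he _).mpr ⟨α, h⟩, α₀ • L 1,
      Submodule.smul_mem _ _ (Submodule.mem_span_singleton_self _), sub_add_cancel _ _⟩
  · rintro ⟨w, hw, z, hz, hwz⟩
    obtain ⟨α₀, rfl⟩ := Submodule.mem_span_singleton.mp hz
    obtain ⟨α, hα⟩ := (mem_topologicalClosure_span_iff_hasSum he _).mp hw
    exact ⟨α₀, α, by rwa [← hwz, add_sub_cancel_right]⟩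

theorem subset_generatedSystem (hip : ∀ a b, ip a b = ⟪L a, L b⟫_ℂ)
    (horth : X.Pairwise fun a b => ip a b = 0) : X ⊆ generatedSystem ip X := by
  rw [generatedSystem_eq_preimage hip horth]
  exact fun O hO => Submodule.mem_sup_left
    (Submodule.le_topologicalClosure _ (Submodule.subset_span (Set.mem_image_of_mem L hO)))

/-- The system generated by pairwise orthogonal self-adjoint elements is an operator system, if the
involution is a closable operator of the Hilbert space. -/
theorem isOperatorSystem_generatedSystem (hip : ∀ a b, ip a b = ⟪L a, L b⟫_ℂ)
    (hL : Continuous L)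
    (hclosable : ∀ w, (0, w) ∈ closure (Set.range fun a : A => (L a, L (star a))) → w = 0)
    (horth : X.Pairwise fun a b => ip a b = 0) (hX : ∀ a ∈ X, IsSelfAdjoint a) :
    IsOperatorSystem (generatedSystem ip X) := by
  have he : Pairwise fun O P : X => ⟪L O, L P⟫_ℂ = 0 := fun O P hOP => by
    change ⟪L O, L P⟫_ℂ = 0
    rw [← hip]
    exact horth O.2 P.2 fun h => hOP (Subtype.ext h)
  have heq := generatedSystem_eq_preimage hip horth
  refine ⟨⟨_, heq.symm⟩, ?_, fun a ha => ?_, ?_⟩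
  · rw [heq]
    exact Submodule.mem_sup_right (Submodule.mem_span_singleton_self _)
  · rw [mem_generatedSystem_iff_hasSum hip] at ha ⊢
    obtain ⟨α₀, α, hα⟩ := ha
    obtain ⟨w, hw⟩ := summable_smul_of_norm_eq he
      (β := fun O => starRingEnd ℂ (α O)) (fun O => (RCLike.norm_conj _).symm) hα.summable
    refine ⟨starRingEnd ℂ α₀, fun O => starRingEnd ℂ (α O), ?_⟩
    -- Conjugated coefficients give some sum `w`. The remainders `b F` satisfy `L (b F) → 0`, while
    -- `L (star (b F))` tends to the difference below, as the elements of `X` are self-adjoint;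
    -- closability makes it zero.
    suffices h : L (star a) - starRingEnd ℂ α₀ • L 1 - w = 0 by
      rwa [sub_eq_zero.mp h]
    refine hclosable _ ?_
    let b : Finset X → A := fun F => a - α₀ • (1 : A) - ∑ O ∈ F, α O • (O : A)
    have hb1 : ∀ F, L (b F) = L a - α₀ • L 1 - ∑ O ∈ F, α O • L O := fun F => by simp [b]
    have hb2 : ∀ F, L (star (b F)) =
        L (star a) - starRingEnd ℂ α₀ • L 1 - ∑ O ∈ F, starRingEnd ℂ (α O) • L O := fun F => by
      have : ∀ O : X, star (O : A) = O := fun O => hX O O.2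
      simp [b, star_sub, star_sum, star_smul, this]
    have h1 : Tendsto (fun F => L (b F)) atTop (𝓝 0) := by
      simp only [hb1]
      have := hα.const_sub (L a - α₀ • L 1)
      rwa [sub_self] at this
    have h2 : Tendsto (fun F => L (star (b F))) atTop
        (𝓝 (L (star a) - starRingEnd ℂ α₀ • L 1 - w)) := by
      simp only [hb2]
      exact hw.const_sub _
    exact mem_closure_of_tendsto (h1.prodMk_nhds h2)
      (Eventually.of_forall fun F => Set.mem_range_self (b F))
  · rw [heq]
    -- Adding a line keeps a closed subspace closed, so `1` need not be orthogonal to `X`.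
    exact (Submodule.isClosed_sup_finiteDimensional _ _
      (Submodule.isClosed_topologicalClosure _)).preimage hL

end GeneratedSystem

/-! ### Ranges and functional calculus of bounded self-adjoint operators. -/

section BoundedOperators

variable {H : Type*} [NormedAddCommGroup H] [InnerProductSpace ℂ H] [CompleteSpace H]

theorem denseRange_of_isSelfAdjoint {R : H →L[ℂ] H} (hR : IsSelfAdjoint R)
    (hinj : ∀ x, R x = 0 → x = 0) : DenseRange R := by
  have h : R.rangeᗮ = ⊥ := by
    rw [R.orthogonal_range, hR.adjoint_eq, eq_bot_iff]
    exact fun x hx => hinj x hx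
  exact Submodule.dense_iff_topologicalClosure_eq_top.mpr
    ((Submodule.topologicalClosure_eq_top_iff).mpr h)

/-- A vector that defines a functional which is bounded relative to an injective self-adjoint
operator lies in the range of this operator. -/
theorem exists_apply_eq_of_norm_inner_le {R : H →L[ℂ] H} (hR : IsSelfAdjoint R)
    (hinj : ∀ x, R x = 0 → x = 0) {w : H} {C : ℝ} (hC : 0 ≤ C)
    (hw : ∀ x, ‖⟪w, x⟫_ℂ‖ ≤ C * ‖R x‖) : ∃ y, R y = w ∧ ‖y‖ ≤ C := by
  have hd : DenseRange (R : H →ₗ[ℂ] H) := denseRange_of_isSelfAdjoint hR hinj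
  let f : H →ₗ[ℂ] ℂ := (innerSL ℂ w : H →ₗ[ℂ] ℂ)
  -- The functional `R x ↦ ⟪w, x⟫` is bounded on a dense subspace. Its Riesz vector `y` satisfies
  -- `⟪y, R x⟫ = ⟪w, x⟫`, hence `R y = w`.
  let g : H →L[ℂ] ℂ := f.extendOfNorm (R : H →ₗ[ℂ] H)
  have hg : ∀ x, g (R x) = ⟪w, x⟫_ℂ := LinearMap.extendOfNorm_eq hd ⟨C, hw⟩
  refine ⟨(InnerProductSpace.toDual ℂ H).symm g, ?_, ?_⟩
  · refine ext_inner_right ℂ fun x => ?_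
    rw [← hg x, ← InnerProductSpace.toDual_symm_apply]
    exact (ContinuousLinearMap.isSelfAdjoint_iff_isSymmetric.mp hR) _ _
  · rw [LinearIsometryEquiv.norm_map]
    exact LinearMap.opNorm_extendOfNorm_le hd hC hw

/-- A closed subspace that is invariant under a pair of self-adjoint operators is invariant under
the functional calculus of this pair. -/
theorem cfc_prod_mem {S T : H →L[ℂ] H} (hS : IsSelfAdjoint S) (hT : IsSelfAdjoint T)
    (hS' : spectrum ℝ S ⊆ Set.Icc 0 1) (hT' : spectrum ℝ T ⊆ Set.Icc 0 1) {f : ℝ → ℝ}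
    (hf : ContinuousOn f (Set.Icc 0 1)) (V : Submodule ℝ (H × H)) (hV : IsClosed (V : Set (H × H)))
    (hinv : ∀ p ∈ V, (S p.1, T p.2) ∈ V) {p : H × H} (hp : p ∈ V) :
    (cfc f S p.1, cfc f T p.2) ∈ V := by
  -- The same Weierstrass polynomials serve both operators. They are real because `V` is only a real
  -- subspace, as is the graph of an antilinear map.
  choose q hq using fun n : ℕ => exists_polynomial_near_of_continuousOn 0 1 f hf (1 / (n + 1))
    Nat.one_div_pos_of_nat
  have happrox : ∀ B : H →L[ℂ] H, IsSelfAdjoint B → spectrum ℝ B ⊆ Set.Icc 0 1 →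
      Tendsto (fun n => Polynomial.aeval B (q n)) atTop (𝓝 (cfc f B)) := by
    intro B hB hB'
    rw [tendsto_iff_norm_sub_tendsto_zero]
    refine squeeze_zero (fun _ => norm_nonneg _) (fun n => ?_)
      tendsto_one_div_add_atTop_nhds_zero_nat
    rw [← cfc_polynomial (q n) B, ← cfc_sub _ _ B (by fun_prop) (hf.mono hB')]
    exact norm_cfc_le (by positivity) fun x hx => (hq n x (hB' hx)).le
  have hpoly : ∀ (r : Polynomial ℝ), (Polynomial.aeval S r p.1, Polynomial.aeval T r p.2) ∈ V := by
    intro r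
    induction r using Polynomial.induction_on with
    | C a =>
      have h : (a • p.1, a • p.2) ∈ V := V.smul_mem a hp
      simpa [Polynomial.aeval_C, Algebra.algebraMap_eq_smul_one] using h
    | add r s hr hs =>
      have h := V.add_mem hr hs
      simpa using h
    | monomial n a h =>
      have h := hinv _ h
      have hcomm : ∀ B : H →L[ℂ] H, Polynomial.aeval B (Polynomial.C a * Polynomial.X ^ (n + 1)) =
          B * Polynomial.aeval B (Polynomial.C a * Polynomial.X ^ n) := by
        intro B
        rw [pow_succ, ← mul_assoc, mul_comm, map_mul, Polynomial.aeval_X]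
      rw [hcomm, hcomm]
      exact h
  have hlim : ∀ B : H →L[ℂ] H, IsSelfAdjoint B → spectrum ℝ B ⊆ Set.Icc 0 1 → ∀ x,
      Tendsto (fun n => Polynomial.aeval B (q n) x) atTop (𝓝 (cfc f B x)) := fun B hB hB' x =>
    ((ContinuousLinearMap.apply ℂ H x).continuous.tendsto _).comp (happrox B hB hB')
  exact hV.mem_of_tendsto ((hlim S hS hS' p.1).prodMk_nhds (hlim T hT hT' p.2))
    (Eventually.of_forall fun n => hpoly (q n))

end BoundedOperators

/-! ### Complex powers that are continuous up to the origin. -/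

section ComplexPowers

/-- The exponents `w` for which `l ↦ l ^ w` is continuous for `0 ≤ l`. -/
def IsAdmissible (w : ℂ) : Prop := w = 0 ∨ 0 < w.re

theorem IsAdmissible.of_re_pos {w : ℂ} (hw : 0 < w.re) : IsAdmissible w := Or.inr hw

theorem isAdmissible_zero : IsAdmissible 0 := Or.inl rfl

/-- At `x = 0` both sides vanish when the real parts are positive, and the exponent `0` is harmless
because `0 ^ 0 = 1`. -/
theorem IsAdmissible.cpow_add {w w' : ℂ} (hw : IsAdmissible w) (hw' : IsAdmissible w') (x : ℂ) :
    x ^ (w + w') = x ^ w * x ^ w' := by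
  rcases hw with rfl | hw
  · simp
  rcases hw' with rfl | hw'
  · simp
  rcases eq_or_ne x 0 with rfl | hx
  · have h : ∀ z : ℂ, 0 < z.re → z ≠ 0 := by
      rintro z hz rfl
      simp at hz
    rw [Complex.zero_cpow (h w hw), Complex.zero_cpow (h (w + w') (by simpa using add_pos hw hw')),
      zero_mul]
  · exact Complex.cpow_add _ _ hx

theorem IsAdmissible.continuous {w : ℂ} (hw : IsAdmissible w) :
    Continuous fun x : ℝ => (x : ℂ) ^ w := by
  rcases hw with rfl | hw
  · simpa using continuous_const
  · exact Complex.continuous_ofReal_cpow_const hw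

theorem ofReal_cpow_conj {x : ℝ} (hx : 0 ≤ x) (w : ℂ) :
    (x : ℂ) ^ (starRingEnd ℂ w) = starRingEnd ℂ ((x : ℂ) ^ w) := by
  rw [Complex.cpow_conj _ _ (by rw [Complex.arg_ofReal_of_nonneg hx]; exact Real.pi_pos.ne),
    Complex.conj_ofReal]

end ComplexPowers

/-! ### Modular theory through bounded functions of the resolvent. -/

section ModularTheory

variable {A : Type*} [CStarAlgebra A] [PartialOrder A] [StarOrderedRing A] (ψ : A →ₚ[ℂ] ℂ)

/-! ### The resolvent and its powers -/

/-- Pairing `z = S R x` with itself through the adjoint relation gives `‖z‖² = ⟪x - R x, R x⟫`. The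
resulting identity yields `R ≥ 0` and shows that `‖R ^ (1/2) x‖` is the graph norm of `S` at `R x`.
-/
theorem exists_tomita_resolvent (x : ψ.GNS) : ∃ z,
    (modularResolvent ψ x, z) ∈ tomitaGraph ψ ∧
      IsTomitaAdjoint ψ z (x - modularResolvent ψ x) ∧
      ⟪x, modularResolvent ψ x⟫_ℂ =
        ((‖modularResolvent ψ x‖ ^ 2 + ‖z‖ ^ 2 : ℝ) : ℂ) := by
  obtain ⟨z, hz, hz'⟩ := modularResolvent_mem ψ x
  refine ⟨z, hz, hz', ?_⟩
  have h := hz'.inner_eq hz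
  rw [inner_sub_left, inner_self_eq_norm_sq_to_K, inner_self_eq_norm_sq_to_K] at h
  push_cast
  simp only [Complex.coe_algebraMap] at h
  linear_combination -h

theorem norm_modularResolvent_le : ‖modularResolvent ψ‖ ≤ 1 :=
  ContinuousLinearMap.opNorm_le_bound _ zero_le_one fun x => by
    rw [one_mul]
    exact norm_le_of_mem_modularGraph (modularResolvent_mem ψ x)

theorem modularResolvent_nonneg : 0 ≤ modularResolvent ψ := by
  rw [ContinuousLinearMap.nonneg_iff_isPositive, ContinuousLinearMap.isPositive_def']
  refine ⟨modularResolvent_isSelfAdjoint ψ, fun x => ?_⟩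
  obtain ⟨z, -, -, h⟩ := exists_tomita_resolvent ψ x
  rw [ContinuousLinearMap.reApplyInnerSelf_apply, inner_re_symm, h]
  change 0 ≤ (((‖modularResolvent ψ x‖ ^ 2 + ‖z‖ ^ 2 : ℝ) : ℂ)).re
  rw [Complex.ofReal_re]
  positivity

theorem spectrum_modularResolvent_subset :
    spectrum ℝ (modularResolvent ψ) ⊆ Set.Icc 0 1 := by
  intro l hl
  refine ⟨spectrum_nonneg_of_nonneg (modularResolvent_nonneg ψ) hl, ?_⟩
  have h := spectrum.norm_le_norm_mul_of_mem hl
  have h1 : ‖(1 : ψ.GNS →L[ℂ] ψ.GNS)‖ ≤ 1 := ContinuousLinearMap.norm_id_le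
  have h2 := mul_le_mul (norm_modularResolvent_le ψ) h1 (norm_nonneg _) zero_le_one
  rw [one_mul] at h2
  exact (le_abs_self l).trans (h.trans h2)

theorem exists_real_of_mem_spectrum {l : ℂ} (hl : l ∈ spectrum ℂ (modularResolvent ψ)) :
    ∃ r ∈ Set.Icc (0 : ℝ) 1, l = r := by
  have hr := (modularResolvent_isSelfAdjoint ψ).mem_spectrum_eq_re hl
  refine ⟨l.re, spectrum_modularResolvent_subset ψ ?_, hr⟩
  rw [← spectrum.preimage_algebraMap ℂ, Set.mem_preimage]
  rw [hr] at hl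
  exact hl

/-- The bounded operator `Δ ^ z (1 + Δ) ^ (- z - w)`. In terms of the spectral variable `l` of
`(1 + Δ)⁻¹` this is `(1 - l) ^ z * l ^ w`. -/
noncomputable def resolventPow (z w : ℂ) : ψ.GNS →L[ℂ] ψ.GNS :=
  cfc (fun l : ℂ => (1 - l) ^ z * l ^ w) (modularResolvent ψ)

variable {ψ} in
-- The powers have a branch cut in `ℂ`, but the spectrum lies in `[0, 1]`, where `l` may be replaced
-- by `l.re`. Without continuity `cfc` would take its default value `0`.
theorem continuousOn_resolventPow {z w : ℂ} (hz : IsAdmissible z) (hw : IsAdmissible w) :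
    ContinuousOn (fun l : ℂ => (1 - l) ^ z * l ^ w) (spectrum ℂ (modularResolvent ψ)) := by
  have h : Continuous fun l : ℂ => ((1 - l.re : ℝ) : ℂ) ^ z * (l.re : ℂ) ^ w :=
    (hz.continuous.comp (continuous_const.sub Complex.continuous_re)).mul
      (hw.continuous.comp Complex.continuous_re)
  refine h.continuousOn.congr fun l hl => ?_
  obtain ⟨r, -, rfl⟩ := exists_real_of_mem_spectrum ψ hl
  simp

theorem resolventPow_mul {z w z' w' : ℂ} (hz : IsAdmissible z) (hw : IsAdmissible w)
    (hz' : IsAdmissible z') (hw' : IsAdmissible w') :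
    resolventPow ψ z w * resolventPow ψ z' w' = resolventPow ψ (z + z') (w + w') := by
  rw [resolventPow, resolventPow, ← cfc_mul _ _ _ (continuousOn_resolventPow hz hw)
    (continuousOn_resolventPow hz' hw')]
  refine cfc_congr fun l _ => ?_
  simp only [hz.cpow_add hz', hw.cpow_add hw']
  ring

theorem star_resolventPow (z w : ℂ) :
    star (resolventPow ψ z w) = resolventPow ψ (starRingEnd ℂ z) (starRingEnd ℂ w) := by
  rw [resolventPow, ← cfc_star]
  refine cfc_congr fun l hl => ?_
  obtain ⟨r, hr, rfl⟩ := exists_real_of_mem_spectrum ψ hl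
  have h1 := ofReal_cpow_conj (sub_nonneg.mpr hr.2) z
  have h2 := ofReal_cpow_conj hr.1 w
  push_cast at h1
  simp only [h1, h2, star_mul', RCLike.star_def]

theorem resolventPow_zero_one : resolventPow ψ 0 1 = modularResolvent ψ := by
  have : IsStarNormal (modularResolvent ψ) := (modularResolvent_isSelfAdjoint ψ).isStarNormal
  simpa [resolventPow] using cfc_id' ℂ (modularResolvent ψ)

theorem inner_resolventPow (z w : ℂ) (x y : ψ.GNS) : ⟪x, resolventPow ψ z w y⟫_ℂ =
    ⟪resolventPow ψ (starRingEnd ℂ z) (starRingEnd ℂ w) x, y⟫_ℂ := by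
  rw [← star_resolventPow, ContinuousLinearMap.star_eq_adjoint,
    ContinuousLinearMap.adjoint_inner_left]

theorem resolventPow_resolventPow {z w z' w' : ℂ} (hz : IsAdmissible z) (hw : IsAdmissible w)
    (hz' : IsAdmissible z') (hw' : IsAdmissible w') (x : ψ.GNS) :
    resolventPow ψ z w (resolventPow ψ z' w' x) = resolventPow ψ (z + z') (w + w') x := by
  rw [← resolventPow_mul ψ hz hw hz' hw']
  rfl

theorem norm_resolventPow_le_one {z w : ℂ} (hz : IsAdmissible z) (hw : IsAdmissible w) :
    ‖resolventPow ψ z w‖ ≤ 1 := by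
  refine norm_cfc_le zero_le_one fun l hl => ?_
  obtain ⟨r, hr, rfl⟩ := exists_real_of_mem_spectrum ψ hl
  have key : ∀ {v : ℂ} (_ : IsAdmissible v) {s : ℝ} (_ : 0 ≤ s) (_ : s ≤ 1),
      ‖(s : ℂ) ^ v‖ ≤ 1 := by
    rintro v (rfl | hv) s hs hs'
    · simp
    · rw [Complex.norm_cpow_eq_rpow_re_of_nonneg hs hv.ne']
      exact Real.rpow_le_one hs hs' hv.le
  have h1 := key hz (sub_nonneg.mpr hr.2) (sub_le_self 1 hr.1)
  have h2 := key hw hr.1 hr.2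
  push_cast at h1
  rw [norm_mul]
  exact mul_le_one₀ h1 (norm_nonneg _) h2

/-- The norm of `(1 - l) ^ z * l ^ w` depends only on the real parts of the exponents. -/
theorem norm_resolventPow_eq {z w z' w' : ℂ} (hz : IsAdmissible z) (hw : IsAdmissible w)
    (hz' : IsAdmissible z') (hw' : IsAdmissible w') (hzz' : z.re = z'.re) (hww' : w.re = w'.re)
    (x : ψ.GNS) : ‖resolventPow ψ z w x‖ = ‖resolventPow ψ z' w' x‖ := by
  have hconj : ∀ {v : ℂ}, IsAdmissible v → IsAdmissible (starRingEnd ℂ v) := by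
    rintro v (rfl | hv)
    · simpa using isAdmissible_zero
    · exact .of_re_pos (by simpa using hv)
  -- `‖T x‖² = ⟪T⋆ T x, x⟫`, and in `T⋆ T` each exponent is added to its conjugate, which leaves
  -- twice the real part.
  have key : ∀ {z w : ℂ}, IsAdmissible z → IsAdmissible w →
      ((‖resolventPow ψ z w x‖ ^ 2 : ℝ) : ℂ) =
        ⟪resolventPow ψ ((2 * z.re : ℝ) : ℂ) ((2 * w.re : ℝ) : ℂ) x, x⟫_ℂ := by
    intro z w hz hw
    have h := inner_self_eq_norm_sq_to_K (𝕜 := ℂ) (resolventPow ψ z w x)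
    have hs := inner_resolventPow ψ (starRingEnd ℂ z) (starRingEnd ℂ w) (resolventPow ψ z w x) x
    rw [Complex.conj_conj, Complex.conj_conj,
      resolventPow_resolventPow ψ hz hw hz hw] at hs
    rw [inner_resolventPow, resolventPow_resolventPow ψ (hconj hz) (hconj hw) hz hw,
      add_comm, Complex.add_conj, add_comm, Complex.add_conj] at h
    rw [h]
    simp
  have h := (key hz hw).trans ((by rw [hzz', hww']) : _ = _) |>.trans (key hz' hw').symm
  exact (sq_eq_sq₀ (norm_nonneg _) (norm_nonneg _)).mp (Complex.ofReal_injective h)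

/-! ### The square root of the resolvent -/

theorem conj_half : starRingEnd ℂ (1 / 2) = 1 / 2 := by
  rw [map_div₀, map_one, Complex.conj_ofNat]

theorem conj_quarter : starRingEnd ℂ (1 / 4) = 1 / 4 := by
  rw [map_div₀, map_one, Complex.conj_ofNat]

theorem isAdmissible_half : IsAdmissible (1 / 2) := .of_re_pos (by norm_num)

theorem isAdmissible_one : IsAdmissible 1 := .of_re_pos (by norm_num)

theorem sqrt_sqrt (x : ψ.GNS) :
    resolventPow ψ 0 (1 / 2) (resolventPow ψ 0 (1 / 2) x) = modularResolvent ψ x := by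
  rw [resolventPow_resolventPow ψ isAdmissible_zero isAdmissible_half isAdmissible_zero
    isAdmissible_half, add_zero, add_halves, resolventPow_zero_one]

theorem sqrt_isSelfAdjoint : IsSelfAdjoint (resolventPow ψ 0 (1 / 2)) := by
  rw [IsSelfAdjoint, star_resolventPow, map_zero, conj_half]

theorem sqrt_injective (x : ψ.GNS) (hx : resolventPow ψ 0 (1 / 2) x = 0) : x = 0 := by
  refine modularResolvent_injective ψ ?_
  rw [← sqrt_sqrt, hx, map_zero]

theorem norm_sqrt_sq (x : ψ.GNS) :
    ((‖resolventPow ψ 0 (1 / 2) x‖ ^ 2 : ℝ) : ℂ) = ⟪x, modularResolvent ψ x⟫_ℂ := by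
  rw [← sqrt_sqrt, inner_resolventPow, map_zero, conj_half]
  simp

variable {ψ} in
/-- The domain of the Tomita operator is contained in that of `Δ ^ (1 / 2)`, which is the range of
`(1 + Δ) ^ (- 1 / 2)`. -/
theorem exists_sqrt_eq {x y : ψ.GNS} (hxy : (x, y) ∈ tomitaGraph ψ) :
    ∃ v, resolventPow ψ 0 (1 / 2) v = x ∧ ‖v‖ ≤ ‖x‖ + ‖y‖ := by
  refine exists_apply_eq_of_norm_inner_le (sqrt_isSelfAdjoint ψ) (sqrt_injective ψ)
    (by positivity) fun x' => ?_
  obtain ⟨z, hz, hz', h⟩ := exists_tomita_resolvent ψ x'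
  rw [← norm_sqrt_sq] at h
  have h1 : ‖resolventPow ψ 0 (1 / 2) x'‖ ^ 2 = ‖modularResolvent ψ x'‖ ^ 2 + ‖z‖ ^ 2 :=
    Complex.ofReal_injective h
  have hR : ‖modularResolvent ψ x'‖ ≤ ‖resolventPow ψ 0 (1 / 2) x'‖ :=
    (sq_le_sq₀ (norm_nonneg _) (norm_nonneg _)).mp (by nlinarith [sq_nonneg ‖z‖])
  have hZ : ‖z‖ ≤ ‖resolventPow ψ 0 (1 / 2) x'‖ :=
    (sq_le_sq₀ (norm_nonneg _) (norm_nonneg _)).mp (by nlinarith [sq_nonneg ‖modularResolvent ψ x'‖])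
  -- With `z = S R x'`, the adjoint relation trades `⟪x' - R x', x⟫` for `⟪y, z⟫`; both `‖R x'‖` and
  -- `‖z‖` are at most `‖R ^ (1/2) x'‖`.
  have h2 : ⟪x', x⟫_ℂ = ⟪modularResolvent ψ x', x⟫_ℂ + ⟪y, z⟫_ℂ := by
    rw [hz'.inner_eq hxy, inner_sub_left]
    ring
  rw [norm_inner_symm, h2]
  calc _ ≤ ‖modularResolvent ψ x'‖ * ‖x‖ + ‖y‖ * ‖z‖ :=
        (norm_add_le _ _).trans (add_le_add (norm_inner_le_norm _ _) (norm_inner_le_norm _ _))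
    _ ≤ ‖resolventPow ψ 0 (1 / 2) x'‖ * ‖x‖ + ‖y‖ * ‖resolventPow ψ 0 (1 / 2) x'‖ := by gcongr
    _ = _ := by ring

theorem ket_mem_tomitaGraph (a : A) : (ket ψ a, ket ψ (star a)) ∈ tomitaGraph ψ :=
  subset_closure ⟨a, rfl⟩

/-- The vector `(1 + Δ) ^ (1 / 2) |a⟩`. -/
noncomputable def graphVector : A →ₗ[ℂ] ψ.GNS where
  toFun a := (exists_sqrt_eq (ket_mem_tomitaGraph ψ a)).choose
  map_add' a b := by
    have h := fun a => (exists_sqrt_eq (ket_mem_tomitaGraph ψ a)).choose_spec.1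
    rw [← sub_eq_zero]
    refine sqrt_injective ψ _ ?_
    rw [map_sub, map_add (resolventPow ψ 0 (1 / 2)), h, h, h, map_add, sub_self]
  map_smul' c a := by
    have h := fun a => (exists_sqrt_eq (ket_mem_tomitaGraph ψ a)).choose_spec.1
    rw [← sub_eq_zero]
    refine sqrt_injective ψ _ ?_
    rw [map_sub, map_smul (resolventPow ψ 0 (1 / 2)), h, h, map_smul, RingHom.id_apply, sub_self]

theorem sqrt_graphVector (a : A) : resolventPow ψ 0 (1 / 2) (graphVector ψ a) = ket ψ a :=
  (exists_sqrt_eq (ket_mem_tomitaGraph ψ a)).choose_spec.1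

theorem norm_graphVector_le (a : A) : ‖graphVector ψ a‖ ≤ ‖ket ψ a‖ + ‖ket ψ (star a)‖ :=
  (exists_sqrt_eq (ket_mem_tomitaGraph ψ a)).choose_spec.2

/-! ### The correlators -/

/-- Writing `|b⟩ = R ^ (1/2) v` supplies the missing half power of `R`: the functional defined by `Δ
^ (1/2 + i t) R |b⟩` is then bounded by `‖v‖ * ‖R x‖`, so this vector lies in the range of `R`. The
phase `i t` does not affect norms. -/
theorem exists_modularPow_ket (b : A) (t : ℝ) : ∃ y, ‖y‖ ≤ ‖graphVector ψ b‖ ∧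
    (ket ψ b, y) ∈ (modularPow ψ (1 / 2 + t * Complex.I)).graph := by
  have h1 : IsAdmissible (1 / 2 + t * Complex.I) := .of_re_pos (by simp)
  have h2 : IsAdmissible (1 - (1 / 2 + t * Complex.I)) := .of_re_pos (by norm_num)
  have h3 : IsAdmissible (1 / 2 - t * Complex.I) := .of_re_pos (by simp)
  have h4 : IsAdmissible (1 + t * Complex.I) := .of_re_pos (by simp)
  obtain ⟨y, hy, hy'⟩ := exists_apply_eq_of_norm_inner_le (modularResolvent_isSelfAdjoint ψ)
    (fun x => modularResolvent_injective ψ) (norm_nonneg (graphVector ψ b))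
    (w := modularPowResolvent ψ (1 / 2 + t * Complex.I) (ket ψ b)) fun x => by
      change ‖⟪resolventPow ψ (1 / 2 + t * Complex.I) (1 - (1 / 2 + t * Complex.I)) (ket ψ b),
        x⟫_ℂ‖ ≤ _
      rw [← sqrt_graphVector, resolventPow_resolventPow ψ h1 h2 isAdmissible_zero
        isAdmissible_half, norm_inner_symm, inner_resolventPow]
      have hR : ‖resolventPow ψ (1 / 2) 1 x‖ ≤ ‖modularResolvent ψ x‖ := by
        have h := resolventPow_resolventPow ψ isAdmissible_half isAdmissible_zero
          isAdmissible_zero isAdmissible_one x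
        rw [resolventPow_zero_one, add_zero, zero_add] at h
        rw [← h]
        exact ContinuousLinearMap.le_of_opNorm_le _
          (norm_resolventPow_le_one ψ isAdmissible_half isAdmissible_zero) _ |>.trans_eq
            (one_mul _)
      have heq : ‖resolventPow ψ (starRingEnd ℂ (1 / 2 + t * Complex.I + 0))
          (starRingEnd ℂ (1 - (1 / 2 + t * Complex.I) + 1 / 2)) x‖ =
          ‖resolventPow ψ (1 / 2) 1 x‖ :=
        norm_resolventPow_eq ψ (.of_re_pos (by simp)) (.of_re_pos (by norm_num))
          isAdmissible_half isAdmissible_one (by simp) (by norm_num) x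
      refine (norm_inner_le_norm _ _).trans ?_
      rw [heq, mul_comm]
      gcongr
  exact ⟨y, hy', (mem_graph_modularPow ψ _ _ _).mpr hy⟩

theorem ket_mem_domain_modularPow (b : A) (t : ℝ) :
    ket ψ b ∈ (modularPow ψ (1 / 2 + t * Complex.I)).domain := by
  obtain ⟨y, -, hy⟩ := exists_modularPow_ket ψ b t
  exact LinearPMap.mem_domain_of_mem_graph hy

variable {ψ} in
theorem modularCorrelator_eq_of_mem_graph {a b : A} {t : ℝ} {y : ψ.GNS}
    (hy : (ket ψ b, y) ∈ (modularPow ψ (1 / 2 + t * Complex.I)).graph) :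
    modularCorrelator ψ a b t = ⟪ket ψ a, y⟫_ℂ := by
  have hb := ket_mem_domain_modularPow ψ b t
  rw [modularCorrelator, dif_pos hb]
  congr 1
  exact LinearPMap.mem_graph_snd_inj _ (LinearPMap.mem_graph _ ⟨ket ψ b, hb⟩) hy rfl

theorem norm_modularCorrelator_le (a b : A) (t : ℝ) :
    ‖modularCorrelator ψ a b t‖ ≤ ‖ket ψ a‖ * ‖graphVector ψ b‖ := by
  obtain ⟨y, hy, hy'⟩ := exists_modularPow_ket ψ b t
  rw [modularCorrelator_eq_of_mem_graph hy']
  exact (norm_inner_le_norm _ _).trans (by gcongr)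

/-- One injective factor `R ^ (1/2)` cancels from the equation that defines `Δ ^ (1/2 + i t) |b⟩`,
and the other moves to the left vector. The correlator becomes a bounded sesquilinear expression, in
which adjoints and linearity are immediate. -/
theorem modularCorrelator_eq_inner (a b : A) (t : ℝ) : modularCorrelator ψ a b t =
    ⟪graphVector ψ a, resolventPow ψ (1 / 2 + t * Complex.I) (1 / 2 - t * Complex.I)
      (graphVector ψ b)⟫_ℂ := by
  have h1 : IsAdmissible (1 / 2 + t * Complex.I) := .of_re_pos (by simp)
  have h2 : IsAdmissible (1 / 2 - t * Complex.I) := .of_re_pos (by simp)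
  obtain ⟨y, -, hy⟩ := exists_modularPow_ket ψ b t
  rw [modularCorrelator_eq_of_mem_graph hy, ← sqrt_graphVector]
  rw [mem_graph_modularPow, ← sqrt_graphVector] at hy
  have h3 : modularPowResolvent ψ (1 / 2 + t * Complex.I) =
      resolventPow ψ (1 / 2 + t * Complex.I) (1 / 2 - t * Complex.I) := by
    rw [show (1 / 2 - t * Complex.I : ℂ) = 1 - (1 / 2 + t * Complex.I) by ring]
    rfl
  rw [h3, resolventPow_resolventPow ψ h1 h2 isAdmissible_zero isAdmissible_half, add_comm,
    add_comm (_ - _), ← resolventPow_resolventPow ψ isAdmissible_zero isAdmissible_half h1 h2,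
    ← sqrt_sqrt, ← sub_eq_zero, ← map_sub] at hy
  rw [← sub_eq_zero.mp (sqrt_injective ψ _ hy), inner_resolventPow, map_zero, conj_half]

/-- The adjoint conjugates both exponents, which amounts to `t ↦ -t`. This is the source of the
equivalence of future and past. -/
theorem modularCorrelator_neg (a b : A) (t : ℝ) :
    modularCorrelator ψ a b (-t) = starRingEnd ℂ (modularCorrelator ψ b a t) := by
  rw [modularCorrelator_eq_inner, modularCorrelator_eq_inner, inner_conj_symm,
    inner_resolventPow, map_add, map_sub, conj_half]
  simp [sub_eq_add_neg]

/-- The vector `Δ ^ (1 / 4) |a⟩`. -/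
noncomputable def alternateKet : A →ₗ[ℂ] ψ.GNS :=
  (resolventPow ψ (1 / 4) (1 / 4)).toLinearMap ∘ₗ graphVector ψ

theorem isAdmissible_quarter : IsAdmissible (1 / 4) := .of_re_pos (by norm_num)

theorem modularCorrelator_eq_inner_alternateKet (a b : A) (t : ℝ) : modularCorrelator ψ a b t =
    ⟪alternateKet ψ a, resolventPow ψ (1 / 4 + t * Complex.I) (1 / 4 - t * Complex.I)
      (graphVector ψ b)⟫_ℂ := by
  have h1 : IsAdmissible (1 / 4 + t * Complex.I) := .of_re_pos (by norm_num)
  have h2 : IsAdmissible (1 / 4 - t * Complex.I) := .of_re_pos (by norm_num)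
  have h3 := inner_resolventPow ψ (1 / 4) (1 / 4) (graphVector ψ a)
    (resolventPow ψ (1 / 4 + t * Complex.I) (1 / 4 - t * Complex.I) (graphVector ψ b))
  rw [resolventPow_resolventPow ψ isAdmissible_quarter isAdmissible_quarter h1 h2] at h3
  rw [modularCorrelator_eq_inner]
  have h4 : (1 / 2 + t * Complex.I : ℂ) = 1 / 4 + (1 / 4 + t * Complex.I) := by ring
  have h5 : (1 / 2 - t * Complex.I : ℂ) = 1 / 4 + (1 / 4 - t * Complex.I) := by ring
  rw [h4, h5, h3, conj_quarter]
  rfl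

theorem alternateInner_eq_inner (a b : A) :
    alternateInner ψ a b = ⟪alternateKet ψ a, alternateKet ψ b⟫_ℂ := by
  rw [alternateInner, modularCorrelator_eq_inner_alternateKet]
  simp [alternateKet]

/-- Splitting `1/2 + i t = 1/4 + (1/4 + i t)` puts a quarter power on each vector, and the phase
drops out of the norm. -/
theorem norm_modularCorrelator_le_alternateKet (a b : A) (t : ℝ) :
    ‖modularCorrelator ψ a b t‖ ≤ ‖alternateKet ψ a‖ * ‖alternateKet ψ b‖ := by
  rw [modularCorrelator_eq_inner_alternateKet]
  refine (norm_inner_le_norm _ _).trans_eq ?_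
  rw [norm_resolventPow_eq ψ (.of_re_pos (by norm_num)) (.of_re_pos (by norm_num))
    isAdmissible_quarter isAdmissible_quarter (by simp) (by simp)]
  rfl

/-! ### Continuity of the vectors -/

theorem norm_ket_le (hψ : ψ 1 = 1) (a : A) : ‖ket ψ a‖ ≤ ‖a‖ := by
  have h1 : star a * a ≤ algebraMap ℝ A (‖a‖ ^ 2) := CStarAlgebra.star_mul_le_algebraMap_norm_sq
  have h2 := OrderHomClass.mono ψ h1
  rw [← inner_ket, inner_self_eq_norm_sq_to_K, IsScalarTower.algebraMap_apply ℝ ℂ A,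
    Algebra.algebraMap_eq_smul_one, map_smul, hψ, smul_eq_mul, mul_one] at h2
  refine (sq_le_sq₀ (norm_nonneg _) (norm_nonneg _)).mp ?_
  exact_mod_cast h2

theorem continuous_ket (hψ : ψ 1 = 1) : Continuous (ket ψ) :=
  AddMonoidHomClass.continuous_of_bound (ket ψ) 1 fun a => by
    rw [one_mul]
    exact norm_ket_le ψ hψ a

theorem continuous_alternateKet (hψ : ψ 1 = 1) : Continuous (alternateKet ψ) := by
  have h : Continuous (graphVector ψ) :=
    AddMonoidHomClass.continuous_of_bound (graphVector ψ) 2 fun a => by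
      have h1 := norm_ket_le ψ hψ a
      have h2 := norm_ket_le ψ hψ (star a)
      rw [norm_star] at h2
      linarith [norm_graphVector_le ψ a]
  exact (resolventPow ψ (1 / 4) (1 / 4)).continuous.comp h

theorem apply_eq_inner_ket_one (a : A) : ψ a = ⟪ket ψ 1, ket ψ a⟫_ℂ := by
  rw [inner_ket, star_one, one_mul]

/-- Both pairings in the adjoint relation at `|1⟩` equal `ψ a`, hence `Δ |1⟩ = |1⟩`. -/
theorem modularResolvent_ket_one : modularResolvent ψ (ket ψ 1) = (1 / 2 : ℂ) • ket ψ 1 := by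
  have h1 : (ket ψ 1, ket ψ 1) ∈ modularGraph ψ := by
    refine ⟨ket ψ 1, by simpa using ket_mem_tomitaGraph ψ 1, fun a => ?_⟩
    rw [inner_ket, inner_ket]
    simp
  have h2 := (modularGraph ψ).smul_mem (1 / 2 : ℂ) h1
  refine (existsUnique_modularGraph ψ (ket ψ 1)).unique (modularResolvent_mem ψ _) ?_
  convert h2 using 1
  refine Prod.ext rfl ?_
  change ket ψ 1 - (1 / 2 : ℂ) • ket ψ 1 = (1 / 2 : ℂ) • ket ψ 1
  module

theorem resolventPow_one_zero : resolventPow ψ 1 0 = 1 - modularResolvent ψ := by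
  have : IsStarNormal (modularResolvent ψ) := (modularResolvent_isSelfAdjoint ψ).isStarNormal
  have h : resolventPow ψ 1 0 = cfc (fun l : ℂ => 1 - l) (modularResolvent ψ) := by
    simp [resolventPow]
  rw [h, cfc_sub _ _ _, cfc_const_one _ _, cfc_id' _ _]

/-- The vector `|1⟩` belongs to the spectral value `l = 1/2`, where `(1 - l) * l = 1/4`; this is the
origin of the `4`. Inserting this operator in `⟪1|a⟩` leaves enough powers to split off the quarter
powers that define `alternateKet`, and the remaining factor is a contraction. -/
theorem norm_apply_le_alternateKet (a : A) :
    ‖ψ a‖ ≤ 4 * ‖ket ψ 1‖ * ‖alternateKet ψ a‖ := by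
  have h1 : resolventPow ψ 1 1 (ket ψ 1) = (1 / 4 : ℂ) • ket ψ 1 := by
    have h := resolventPow_resolventPow ψ isAdmissible_one isAdmissible_zero isAdmissible_zero
      isAdmissible_one (ket ψ 1)
    rw [resolventPow_zero_one, modularResolvent_ket_one, resolventPow_one_zero, add_zero,
      zero_add] at h
    rw [← h]
    change (1 / 2 : ℂ) • ket ψ 1 - modularResolvent ψ ((1 / 2 : ℂ) • ket ψ 1) = _
    rw [map_smul, modularResolvent_ket_one]
    module
  have h3 : IsAdmissible (3 / 4) := .of_re_pos (by norm_num)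
  have h5 : IsAdmissible (5 / 4) := .of_re_pos (by norm_num)
  have h2 : ψ a = 4 * ⟪ket ψ 1, resolventPow ψ (3 / 4) (5 / 4) (alternateKet ψ a)⟫_ℂ := by
    have h6 : resolventPow ψ (3 / 4) (5 / 4) (alternateKet ψ a) =
        resolventPow ψ 1 1 (ket ψ a) := by
      rw [← sqrt_graphVector ψ a, resolventPow_resolventPow ψ isAdmissible_one isAdmissible_one
        isAdmissible_zero isAdmissible_half]
      change resolventPow ψ (3 / 4) (5 / 4) (resolventPow ψ (1 / 4) (1 / 4) _) = _
      rw [resolventPow_resolventPow ψ h3 h5 isAdmissible_quarter isAdmissible_quarter]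
      norm_num
    rw [h6, inner_resolventPow, map_one, h1, inner_smul_left, ← apply_eq_inner_ket_one, conj_quarter]
    ring
  rw [h2, norm_mul]
  have h7 : ‖resolventPow ψ (3 / 4) (5 / 4) (alternateKet ψ a)‖ ≤ ‖alternateKet ψ a‖ :=
    (ContinuousLinearMap.le_of_opNorm_le _ (norm_resolventPow_le_one ψ h3 h5) _).trans_eq
      (one_mul _)
  have h8 := norm_inner_le_norm (𝕜 := ℂ) (ket ψ 1)
    (resolventPow ψ (3 / 4) (5 / 4) (alternateKet ψ a))
  have h9 := mul_le_mul_of_nonneg_left h7 (norm_nonneg (ket ψ 1))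
  simp only [Complex.norm_ofNat]
  linarith

/-! ### The antiunitary symmetry -/

variable {ψ} in
theorem tomitaGraph_swap {x y : ψ.GNS} (h : (x, y) ∈ tomitaGraph ψ) :
    (y, x) ∈ tomitaGraph ψ := by
  refine map_mem_closure (f := Prod.swap) continuous_swap h ?_
  rintro _ ⟨a, rfl⟩
  exact ⟨star a, by simp⟩

variable {ψ} in
theorem tomitaGraph_sub {p q : ψ.GNS × ψ.GNS} (hp : p ∈ tomitaGraph ψ)
    (hq : q ∈ tomitaGraph ψ) : p - q ∈ tomitaGraph ψ := by
  have h := tomitaGraph_add hp (tomitaGraph_smul (-1 : ℂ) hq)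
  rw [map_neg, map_one, neg_one_smul, neg_one_smul] at h
  rw [sub_eq_add_neg]
  exact h

variable {ψ} in
/-- `S (1 + Δ)⁻¹ = (1 + Δ⁻¹)⁻¹ S`. -/
theorem tomitaGraph_resolvent {x y : ψ.GNS} (h : (x, y) ∈ tomitaGraph ψ) :
    (modularResolvent ψ x, y - modularResolvent ψ y) ∈ tomitaGraph ψ := by
  obtain ⟨z, hz, hz', -⟩ := exists_tomita_resolvent ψ x
  -- Since `S` is an involution, `S (y - z) = x - R x`, and the adjoint relation is symmetric under
  -- `a ↦ star a`, so `S⋆ (x - R x) = z`. Thus `u = y - z` solves `u + Δ u = y`.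
  have h1 : (y - z, y - (y - z)) ∈ modularGraph ψ := by
    refine ⟨x - modularResolvent ψ x, tomitaGraph_swap (tomitaGraph_sub h hz), fun a => ?_⟩
    have := congrArg (starRingEnd ℂ) (hz' (star a))
    rw [inner_conj_symm, inner_conj_symm, star_star] at this
    change ⟪_, _⟫_ℂ = ⟪y - (y - z), _⟫_ℂ
    rw [sub_sub_cancel]
    exact this.symm
  rw [(existsUnique_modularGraph ψ y).unique (modularResolvent_mem ψ y) h1, sub_sub_cancel]
  exact hz

/-- The graph norm of the Tomita operator `S` is the norm of `(1 + Δ) ^ (1 / 2)`. -/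
theorem exists_tomita_sqrt (hcl : ∀ w, (0, w) ∈ tomitaGraph ψ → w = 0) (v : ψ.GNS) :
    ∃ z, (resolventPow ψ 0 (1 / 2) v, z) ∈ tomitaGraph ψ ∧
      ‖v‖ ^ 2 = ‖resolventPow ψ 0 (1 / 2) v‖ ^ 2 + ‖z‖ ^ 2 := by
  have huniq : ∀ {x z z' : ψ.GNS}, (x, z) ∈ tomitaGraph ψ → (x, z') ∈ tomitaGraph ψ → z = z' := by
    intro x z z' h h'
    have := tomitaGraph_sub h h'
    rw [Prod.mk_sub_mk, sub_self] at this
    exact sub_eq_zero.mp (hcl _ this)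
  choose Z hZ _ hZn using exists_tomita_resolvent ψ
  have hZn' : ∀ x, ‖resolventPow ψ 0 (1 / 2) x‖ ^ 2 =
      ‖modularResolvent ψ x‖ ^ 2 + ‖Z x‖ ^ 2 := fun x =>
    Complex.ofReal_injective ((norm_sqrt_sq ψ x).trans (hZn x))
  -- Single-valuedness makes `S R` an antilinear map. It is dominated by `R ^ (1/2)`, so it factors
  -- through it as a bounded operator `g`, which is `S R ^ (1/2)`.
  let f : ψ.GNS →ₛₗ[starRingEnd ℂ] ψ.GNS :=
    { toFun := Z
      map_add' := fun x y => huniq (hZ _) (by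
        rw [map_add]
        exact tomitaGraph_add (hZ x) (hZ y))
      map_smul' := fun c x => huniq (hZ _) (by
        rw [map_smul]
        exact tomitaGraph_smul c (hZ x)) }
  have hf : ∀ x, ‖f x‖ ≤ 1 * ‖(resolventPow ψ 0 (1 / 2)).toLinearMap x‖ := by
    intro x
    rw [one_mul]
    refine (sq_le_sq₀ (norm_nonneg _) (norm_nonneg _)).mp ?_
    change ‖Z x‖ ^ 2 ≤ ‖resolventPow ψ 0 (1 / 2) x‖ ^ 2
    nlinarith [hZn' x, sq_nonneg ‖modularResolvent ψ x‖]
  have hd : DenseRange (resolventPow ψ 0 (1 / 2)).toLinearMap :=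
    denseRange_of_isSelfAdjoint (sqrt_isSelfAdjoint ψ) (sqrt_injective ψ)
  let g := f.extendOfNorm (resolventPow ψ 0 (1 / 2)).toLinearMap
  have hg : ∀ x, g (resolventPow ψ 0 (1 / 2) x) = Z x :=
    LinearMap.extendOfNorm_eq hd ⟨1, hf⟩
  refine ⟨g v, ?_⟩
  refine hd.induction_on (p := fun v => (resolventPow ψ 0 (1 / 2) v, g v) ∈ tomitaGraph ψ ∧
      ‖v‖ ^ 2 = ‖resolventPow ψ 0 (1 / 2) v‖ ^ 2 + ‖g v‖ ^ 2) v ?_ fun x => ?_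
  · exact (isClosed_closure.preimage (by fun_prop :
      Continuous fun v => (resolventPow ψ 0 (1 / 2) v, g v))).inter
        (isClosed_eq (by fun_prop) (by fun_prop))
  · change (resolventPow ψ 0 (1 / 2) (resolventPow ψ 0 (1 / 2) x),
        g (resolventPow ψ 0 (1 / 2) x)) ∈ tomitaGraph ψ ∧
      ‖resolventPow ψ 0 (1 / 2) x‖ ^ 2 = ‖resolventPow ψ 0 (1 / 2) (resolventPow ψ 0 (1 / 2) x)‖ ^ 2
        + ‖g (resolventPow ψ 0 (1 / 2) x)‖ ^ 2
    rw [hg, sqrt_sqrt]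
    exact ⟨hZ x, hZn' x⟩

variable {ψ} in
-- The norm of `v` is the graph norm of `S` at `R ^ (1/2) v`, which is symmetric under exchanging a
-- vector with its image.
theorem norm_eq_of_sqrt_mem_tomitaGraph (hcl : ∀ w, (0, w) ∈ tomitaGraph ψ → w = 0)
    {v v' : ψ.GNS}
    (h : (resolventPow ψ 0 (1 / 2) v, resolventPow ψ 0 (1 / 2) v') ∈ tomitaGraph ψ) :
    ‖v‖ = ‖v'‖ := by
  have key : ∀ {v v' : ψ.GNS},
      (resolventPow ψ 0 (1 / 2) v, resolventPow ψ 0 (1 / 2) v') ∈ tomitaGraph ψ →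
      ‖v‖ ^ 2 = ‖resolventPow ψ 0 (1 / 2) v‖ ^ 2 + ‖resolventPow ψ 0 (1 / 2) v'‖ ^ 2 := by
    intro v v' h
    obtain ⟨z, hz, hz'⟩ := exists_tomita_sqrt ψ hcl v
    have := tomitaGraph_sub h hz
    rw [Prod.mk_sub_mk, sub_self] at this
    rw [hz', sub_eq_zero.mp (hcl _ this)]
  refine (sq_eq_sq₀ (norm_nonneg _) (norm_nonneg _)).mp ?_
  rw [key h, key (tomitaGraph_swap h), add_comm]

theorem resolventPow_quarter_eq_cfc : resolventPow ψ (1 / 4) (1 / 4) =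
    cfc (fun r : ℝ => (1 - r) ^ (1 / 4 : ℝ) * r ^ (1 / 4 : ℝ)) (modularResolvent ψ) := by
  rw [cfc_real_eq_complex _ (modularResolvent_isSelfAdjoint ψ), resolventPow]
  refine cfc_congr fun l hl => ?_
  obtain ⟨r, hr, rfl⟩ := exists_real_of_mem_spectrum ψ hl
  simp only [Complex.ofReal_re, Complex.ofReal_mul, Complex.ofReal_cpow hr.1,
    Complex.ofReal_cpow (sub_nonneg.mpr hr.2)]
  norm_num

/-- `‖Δ ^ (1 / 4) |a⋆⟩‖ = ‖Δ ^ (1 / 4) |a⟩‖`. -/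
theorem norm_alternateKet_star (hcl : ∀ w, (0, w) ∈ tomitaGraph ψ → w = 0) (a : A) :
    ‖alternateKet ψ (star a)‖ = ‖alternateKet ψ a‖ := by
  -- `V` is the graph of `S` transported by `(1 + Δ) ^ (1/2)`. By `tomitaGraph_resolvent` it is
  -- invariant under the pair `R`, `1 - R`.
  let V : Submodule ℝ (ψ.GNS × ψ.GNS) :=
    { carrier := {p | (resolventPow ψ 0 (1 / 2) p.1, resolventPow ψ 0 (1 / 2) p.2) ∈
        tomitaGraph ψ}
      zero_mem' := subset_closure ⟨0, by simp⟩
      add_mem' := fun {p q} hp hq => by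
        have := tomitaGraph_add hp hq
        simpa using this
      smul_mem' := fun c p hp => by
        have := tomitaGraph_smul (c : ℂ) hp
        simpa using this }
  have hV : IsClosed (V : Set (ψ.GNS × ψ.GNS)) := isClosed_closure.preimage (by fun_prop :
    Continuous fun p : ψ.GNS × ψ.GNS =>
      (resolventPow ψ 0 (1 / 2) p.1, resolventPow ψ 0 (1 / 2) p.2))
  have hcomm : ∀ x, modularResolvent ψ (resolventPow ψ 0 (1 / 2) x) =
      resolventPow ψ 0 (1 / 2) (modularResolvent ψ x) := fun x => by
    rw [← sqrt_sqrt, ← sqrt_sqrt]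
  have hR := modularResolvent_isSelfAdjoint ψ
  have hspec := spectrum_modularResolvent_subset ψ
  let f : ℝ → ℝ := fun r => (1 - r) ^ (1 / 4 : ℝ) * r ^ (1 / 4 : ℝ)
  have hf : Continuous f :=
    ((continuous_const.sub continuous_id).rpow_const fun _ => Or.inr (by norm_num)).mul
      (continuous_id.rpow_const fun _ => Or.inr (by norm_num))
  have h1 : cfc (fun r : ℝ => 1 - r) (modularResolvent ψ) = 1 - modularResolvent ψ := by
    rw [cfc_sub _ _ _, cfc_const_one _ _, cfc_id' _ _]
  -- The exponent `1/4` is special: `(1 - r) ^ (1/4) * r ^ (1/4)` is symmetric under `r ↦ 1 - r`, so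
  -- both components undergo the same operator.
  have h2 : cfc f (1 - modularResolvent ψ) = cfc f (modularResolvent ψ) := by
    rw [← h1, ← cfc_comp' f _ _ hf.continuousOn]
    congr 1
    funext r
    simp only [f, sub_sub_cancel]
    ring
  have hspec' : spectrum ℝ (1 - modularResolvent ψ) ⊆ Set.Icc 0 1 := by
    rw [← h1, cfc_map_spectrum _ _]
    rintro _ ⟨r, hr, rfl⟩
    exact ⟨sub_nonneg.mpr (hspec hr).2, sub_le_self 1 (hspec hr).1⟩
  have hmem : (graphVector ψ a, graphVector ψ (star a)) ∈ V := by
    change (resolventPow ψ 0 (1 / 2) _, resolventPow ψ 0 (1 / 2) _) ∈ tomitaGraph ψ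
    rw [sqrt_graphVector, sqrt_graphVector]
    exact ket_mem_tomitaGraph ψ a
  have h := cfc_prod_mem hR ((IsSelfAdjoint.one _).sub hR) hspec hspec' hf.continuousOn V hV
    (fun p hp => by
      have := tomitaGraph_resolvent hp
      rw [hcomm, hcomm, ← map_sub] at this
      exact this) hmem
  rw [h2, ← resolventPow_quarter_eq_cfc] at h
  exact (norm_eq_of_sqrt_mem_tomitaGraph hcl h).symm

end ModularTheory

/-! ### Closability of the Tomita operator of a faithful normal state. -/

section Closability

variable {K : Type*} [NormedAddCommGroup K] [InnerProductSpace ℂ K] [CompleteSpace K]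
  {M : VonNeumannAlgebra K}

theorem norm_ket_sq {A : Type*} [CStarAlgebra A] [PartialOrder A] [StarOrderedRing A]
    (ψ : A →ₚ[ℂ] ℂ) (a : A) : ((‖ket ψ a‖ ^ 2 : ℝ) : ℂ) = ψ (star a * a) := by
  rw [← inner_ket, inner_self_eq_norm_sq_to_K]
  simp

/-- The vectors of a density matrix of a faithful normal functional are cyclic for the
commutant. -/
theorem commutant_span_eq_top (ξ : ℕ → K)
    (hsep : ∀ a : M, (∀ n, (a : K →L[ℂ] K) (ξ n) = 0) → a = 0) :
    (Submodule.span ℂ {x | ∃ b ∈ M.commutant, ∃ n, x = b (ξ n)}).topologicalClosure = ⊤ := by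
  set W := (Submodule.span ℂ {x | ∃ b ∈ M.commutant, ∃ n, x = b (ξ n)}).topologicalClosure
  have hWc : CompleteSpace W := (Submodule.isClosed_topologicalClosure _).completeSpace_coe
  have hinv : ∀ b ∈ M.commutant, ∀ x ∈ W, b x ∈ W := by
    intro b hb x hx
    refine map_mem_closure b.continuous hx fun y hy => ?_
    refine Submodule.span_induction (p := fun y _ => b y ∈
      Submodule.span ℂ {x | ∃ b ∈ M.commutant, ∃ n, x = b (ξ n)}) ?_ ?_ ?_ ?_ hy
    · rintro _ ⟨c, hc, n, rfl⟩
      exact Submodule.subset_span ⟨b * c, mul_mem hb hc, n, rfl⟩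
    · simp
    · intro u v _ _ hu hv
      rw [map_add]
      exact add_mem hu hv
    · intro c u _ hu
      rw [map_smul]
      exact Submodule.smul_mem _ c hu
  -- `W` is invariant under the `⋆`-closed commutant, so its projection commutes with the commutant
  -- and lies in `M`. Its complement annihilates every `ξ n`, hence vanishes by `hsep`.
  have hP : W.starProjection ∈ M := by
    rw [← M.commutant_commutant, VonNeumannAlgebra.mem_commutant_iff]
    intro b hb
    ext x
    have h1 : b (W.starProjection x) ∈ W := hinv b hb _ (W.starProjection_apply_mem x)
    have h2 : b (x - W.starProjection x) ∈ Wᗮ := by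
      intro w hw
      rw [← ContinuousLinearMap.adjoint_inner_left]
      exact (W.sub_starProjection_mem_orthogonal x) _ (hinv _ (star_mem hb) w hw)
    have h3 : W.starProjection (b x) = b (W.starProjection x) := by
      rw [map_sub] at h2
      exact (Submodule.eq_starProjection_of_mem_of_inner_eq_zero h1 (fun w hw => by
        rw [← inner_conj_symm, h2 w hw, map_zero]))
    exact h3.symm
  have h1 : (1 : M) - ⟨W.starProjection, hP⟩ = 0 := by
    refine hsep _ fun n => ?_
    have : ξ n ∈ W := Submodule.le_topologicalClosure _
      (Submodule.subset_span ⟨1, one_mem _, n, rfl⟩)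
    change ξ n - W.starProjection (ξ n) = 0
    rw [Submodule.starProjection_eq_self_iff.mpr this, sub_self]
  rw [eq_top_iff]
  intro x _
  have h2 : W.starProjection = 1 := (congrArg Subtype.val (sub_eq_zero.mp h1)).symm
  have := W.starProjection_apply_mem x
  rwa [h2] at this

variable {ψ : M →ₚ[ℂ] ℂ} {ξ : ℕ → K}

theorem hasSum_norm_sq (hξ : ∀ a : M, HasSum (fun n => ⟪ξ n, (a : K →L[ℂ] K) (ξ n)⟫_ℂ) (ψ a))
    (a : M) : HasSum (fun n => ‖(a : K →L[ℂ] K) (ξ n)‖ ^ 2) (‖ket ψ a‖ ^ 2) := by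
  have h := hξ (star a * a)
  rw [← norm_ket_sq] at h
  have h' : ∀ n, ⟪ξ n, ((star a * a : M) : K →L[ℂ] K) (ξ n)⟫_ℂ =
      ((‖(a : K →L[ℂ] K) (ξ n)‖ ^ 2 : ℝ) : ℂ) := by
    intro n
    change ⟪ξ n, ContinuousLinearMap.adjoint (a : K →L[ℂ] K) ((a : K →L[ℂ] K) (ξ n))⟫_ℂ = _
    rw [ContinuousLinearMap.adjoint_inner_right, inner_self_eq_norm_sq_to_K]
    simp
  simp only [h'] at h
  exact_mod_cast h

/-- The map `|a⟩ ↦ a ξ` for a vector `ξ` that occurs in a density matrix of the state. -/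
theorem exists_evaluation
    (hξ : ∀ a : M, HasSum (fun n => ⟪ξ n, (a : K →L[ℂ] K) (ξ n)⟫_ℂ) (ψ a)) (n : ℕ) :
    ∃ U : ψ.GNS →L[ℂ] K, ∀ a, U (ket ψ a) = (a : K →L[ℂ] K) (ξ n) := by
  let f : M →ₗ[ℂ] K :=
    { toFun := fun a => (a : K →L[ℂ] K) (ξ n)
      map_add' := fun a b => rfl
      map_smul' := fun c a => rfl }
  have hf : ∀ a, ‖f a‖ ≤ ‖ket ψ a‖ := by
    intro a
    have h := hasSum_norm_sq hξ a
    exact (sq_le_sq₀ (norm_nonneg _) (norm_nonneg _)).mp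
      (le_hasSum h n fun j _ => by positivity)
  refine ⟨f.extendOfNorm (ket ψ), fun a => ?_⟩
  exact LinearMap.extendOfNorm_eq (dense_ket ψ) ⟨1, fun x => by simpa using hf x⟩ a

/-- The Tomita operator of a faithful normal functional is single-valued. -/
theorem tomitaGraph_closable (hψn : IsNormal ψ) (hψf : IsFaithful ψ) {w : ψ.GNS}
    (hw : (0, w) ∈ tomitaGraph ψ) : w = 0 := by
  obtain ⟨ξ, hξ⟩ := hψn
  have hsep : ∀ a : M, (∀ n, (a : K →L[ℂ] K) (ξ n) = 0) → a = 0 := by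
    intro a ha
    refine hψf a ?_
    have h := hasSum_norm_sq hξ a
    simp only [ha, norm_zero, ne_eq, OfNat.ofNat_ne_zero, not_false_eq_true, zero_pow] at h
    rw [← norm_ket_sq, h.unique hasSum_zero, Complex.ofReal_zero]
  choose U hU using exists_evaluation hξ
  have hUw : ∀ n, U n w = 0 := by
    intro n
    have hd : Dense ((Submodule.span ℂ {x | ∃ b ∈ M.commutant, ∃ n, x = b (ξ n)} :
        Submodule ℂ K) : Set K) :=
      Submodule.dense_iff_topologicalClosure_eq_top.mpr (commutant_span_eq_top ξ hsep)
    have hz : ∀ x ∈ Submodule.span ℂ {x | ∃ b ∈ M.commutant, ∃ n, x = b (ξ n)},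
        ⟪x, U n w⟫_ℂ = 0 := by
      intro x hx
      induction hx using Submodule.span_induction with
      | mem x hx =>
        obtain ⟨b, hb, k, rfl⟩ := hx
        have hcl : IsClosed {p : ψ.GNS × ψ.GNS |
            ⟪b (ξ k), U n p.2⟫_ℂ = ⟪U k p.1, star b (ξ n)⟫_ℂ} :=
          isClosed_eq (by fun_prop) (by fun_prop)
        -- For `b` in the commutant, `⟪b ξ_k, a⋆ ξ_n⟫ = ⟪a ξ_k, b⋆ ξ_n⟫`. This relation passes to
        -- the closure, and at `(0, w)` its right side is zero.
        have h : (0, w) ∈ {p : ψ.GNS × ψ.GNS |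
            ⟪b (ξ k), U n p.2⟫_ℂ = ⟪U k p.1, star b (ξ n)⟫_ℂ} := by
          refine closure_minimal ?_ hcl hw
          rintro _ ⟨a, rfl⟩
          have hab := VonNeumannAlgebra.mem_commutant_iff.mp hb a a.2
          change ⟪b (ξ k), U n (ket ψ (star a))⟫_ℂ = ⟪U k (ket ψ a), star b (ξ n)⟫_ℂ
          rw [hU, hU]
          change ⟪b (ξ k), ContinuousLinearMap.adjoint (a : K →L[ℂ] K) (ξ n)⟫_ℂ =
            ⟪_, ContinuousLinearMap.adjoint b (ξ n)⟫_ℂ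
          rw [ContinuousLinearMap.adjoint_inner_right, ContinuousLinearMap.adjoint_inner_right]
          exact congrArg (fun T : K →L[ℂ] K => ⟪T (ξ k), ξ n⟫_ℂ) hab
        simpa using h
      | zero => simp
      | add x y _ _ hx hy => rw [inner_add_left, hx, hy, add_zero]
      | smul c x _ hx => rw [inner_smul_left, hx, mul_zero]
    exact hd.eq_zero_of_inner_right (𝕜 := ℂ) hz
  have hbessel : ∀ (F : Finset ℕ) (x : ψ.GNS), ∑ n ∈ F, ‖U n x‖ ^ 2 ≤ ‖x‖ ^ 2 := by
    intro F x
    refine (dense_ket ψ).induction_on x (isClosed_le (by fun_prop) (by fun_prop)) fun a => ?_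
    simp only [hU]
    exact sum_le_hasSum F (fun n _ => by positivity) (hasSum_norm_sq hξ a)
  refine norm_le_zero_iff.mp (le_of_forall_pos_le_add fun ε hε => ?_)
  obtain ⟨a, ha⟩ := (dense_ket ψ).exists_dist_lt w (half_pos hε)
  -- As every `U n` kills `w`, the norm of `|a⟩` is computed by the values of the `U n` on `w -
  -- |a⟩`. So vectors `|a⟩` close to `w` are small, and `w = 0`.
  have h1 : ‖ket ψ a‖ ^ 2 ≤ ‖w - ket ψ a‖ ^ 2 := by
    refine hasSum_le_of_sum_le (hasSum_norm_sq hξ a) fun F => ?_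
    refine le_trans (le_of_eq (Finset.sum_congr rfl fun n _ => ?_)) (hbessel F (w - ket ψ a))
    rw [map_sub, hUw, zero_sub, norm_neg, hU]
  have h2 := (sq_le_sq₀ (norm_nonneg _) (norm_nonneg _)).mp h1
  rw [dist_eq_norm] at ha
  have h3 := norm_sub_norm_le w (ket ψ a)
  linarith

end Closability

/-! ### Time reversal, and extension of mixing to the generated system. -/

section Mixing

variable {A : Type*} [CStarAlgebra A] [PartialOrder A] [StarOrderedRing A] {ψ : A →ₚ[ℂ] ℂ}

theorem connectedCorrelator_neg (a b : A) (t : ℝ) :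
    connectedCorrelator ψ a b (-t) = starRingEnd ℂ (connectedCorrelator ψ b a t) :=
  modularCorrelator_neg ψ _ _ t

/-- Future mixing is equivalent to past mixing. -/
theorem isFutureMixing_iff_isPastMixing {X : Set A} :
    IsFutureMixing ψ X ↔ IsPastMixing ψ X := by
  have key : ∀ {l l' : Filter ℝ}, Tendsto Neg.neg l' l →
      (∀ a ∈ X, ∀ b ∈ X, Tendsto (connectedCorrelator ψ a b) l (𝓝 0)) →
      ∀ a ∈ X, ∀ b ∈ X, Tendsto (connectedCorrelator ψ a b) l' (𝓝 0) := by
    intro l l' hl h a ha b hb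
    have h1 := (Complex.continuous_conj.tendsto 0).comp ((h b hb a ha).comp hl)
    rw [map_zero] at h1
    refine h1.congr fun t => ?_
    rw [Function.comp_apply, Function.comp_apply, ← connectedCorrelator_neg, neg_neg]
  exact ⟨key tendsto_neg_atBot_atTop, key tendsto_neg_atTop_atBot⟩

theorem isMixing_iff_isFutureMixing {X : Set A} : IsMixing ψ X ↔ IsFutureMixing ψ X :=
  ⟨And.left, fun h => ⟨h, isFutureMixing_iff_isPastMixing.mp h⟩⟩

variable (ψ) in
/-- The connected correlator as a linear functional of its second argument. -/
noncomputable def connectedFunctional (a : A) (t : ℝ) : A →ₗ[ℂ] ℂ where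
  toFun b := connectedCorrelator ψ a b t
  map_add' b c := by
    simp only [connectedCorrelator, modularCorrelator_eq_inner]
    rw [← inner_add_right, ← map_add, ← map_add, map_add ψ, add_smul, add_sub_add_comm]
  map_smul' c b := by
    simp only [connectedCorrelator, modularCorrelator_eq_inner]
    rw [RingHom.id_apply, smul_eq_mul, ← inner_smul_right, ← map_smul, ← map_smul,
      map_smul ψ, smul_sub, smul_assoc]

/-- The system generated by a mixing set is mixing, for an inner product that bounds both the state
and its correlators. -/
theorem isMixing_generatedSystem {H : Type*} [NormedAddCommGroup H] [InnerProductSpace ℂ H]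
    {L : A →ₗ[ℂ] H} {ip : A → A → ℂ} {X : Set A} (hψ : ψ 1 = 1)
    (hip : ∀ a b, ip a b = ⟪L a, L b⟫_ℂ) {c : ℝ} (hc : ∀ a, ‖ψ a‖ ≤ c * ‖L a‖)
    (hL : ∀ b, ∃ C, 0 ≤ C ∧ ∀ a t, ‖modularCorrelator ψ a b t‖ ≤ C * ‖L a‖)
    (hX : IsMixing ψ X) : IsMixing ψ (generatedSystem ip X) := by
  -- Only the second argument is extended here, for an arbitrary fixed `a`; a general filter allows
  -- use in both time directions.
  have hstep : ∀ (l : Filter ℝ) (a : A),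
      (∀ b ∈ X, Tendsto (connectedCorrelator ψ a b) l (𝓝 0)) →
      ∀ b ∈ generatedSystem ip X, Tendsto (connectedCorrelator ψ a b) l (𝓝 0) := by
    intro l a ha b hb
    obtain ⟨C, hC, hC'⟩ := hL (a - ψ a • 1)
    refine tendsto_of_mem_generatedSystem hip (connectedFunctional ψ a)
      (C * (1 + c * ‖L 1‖)) (fun t d => ?_) (fun t => ?_) ha hb
    · change ‖connectedCorrelator ψ a d t‖ ≤ _
      -- `hL` controls the first argument, so time reversal moves `d` there. The factor `1 + c * ‖L
      -- 1‖` accounts for subtracting `ψ d • 1`.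
      rw [← neg_neg t, connectedCorrelator_neg, RCLike.norm_conj]
      refine (hC' _ _).trans ?_
      rw [mul_assoc]
      refine mul_le_mul_of_nonneg_left ?_ hC
      rw [map_sub, map_smul]
      refine (norm_sub_le _ _).trans ?_
      rw [norm_smul]
      have := mul_le_mul_of_nonneg_right (hc d) (norm_nonneg (L 1))
      linarith
    · change connectedCorrelator ψ a 1 t = 0
      simp [connectedCorrelator, modularCorrelator_eq_inner, hψ]
  refine isMixing_iff_isFutureMixing.mpr fun a ha b hb => hstep _ _ (fun d hd => ?_) b hb
  -- Time reversal also extends the first argument: `a` is treated as a second argument in the past,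
  -- and the result is reflected to the future.
  have h1 := hstep atBot d (fun e he => hX.2 d hd e he) a ha
  have h2 := (Complex.continuous_conj.tendsto 0).comp (h1.comp tendsto_neg_atTop_atBot)
  rw [map_zero] at h2
  refine h2.congr fun t => ?_
  rw [Function.comp_apply, Function.comp_apply, ← connectedCorrelator_neg, neg_neg]

end Mixing

end ModularMixing

theorem mainTheorem8 {K : Type*} [NormedAddCommGroup K] [InnerProductSpace ℂ K] [CompleteSpace K]
    (M : VonNeumannAlgebra K) (ψ : M →ₚ[ℂ] ℂ) (hψ_state : ψ 1 = 1)
    (hψ_normal : ModularMixing.IsNormal ψ) (hψ_faithful : ModularMixing.IsFaithful ψ)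
    (ip : M → M → ℂ)
    (hip : ip = ModularMixing.gnsInner ψ ∨ ip = ModularMixing.alternateInner ψ)
    (X : Set M) (hX_countable : X.Countable) (hX_selfAdjoint : ∀ a ∈ X, IsSelfAdjoint a)
    (hX_orthogonal : X.Pairwise fun a b => ip a b = 0)
    (hX_mixing : ModularMixing.IsFutureMixing ψ X ∨ ModularMixing.IsPastMixing ψ X) :
    (∀ (a : M) (t : ℝ), ModularMixing.ket ψ a ∈
      (ModularMixing.modularPow ψ (1 / 2 + t * Complex.I)).domain) ∧
    ModularMixing.IsMixing ψ X ∧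
    X ⊆ ModularMixing.generatedSystem ip X ∧
    ModularMixing.IsOperatorSystem (ModularMixing.generatedSystem ip X) ∧
    ModularMixing.IsMixing ψ (ModularMixing.generatedSystem ip X) := by
  have hcl : ∀ w, (0, w) ∈ ModularMixing.tomitaGraph ψ → w = 0 := fun w hw =>
    ModularMixing.tomitaGraph_closable hψ_normal hψ_faithful hw
  have hmix : ModularMixing.IsMixing ψ X := hX_mixing.elim
    ModularMixing.isMixing_iff_isFutureMixing.mpr fun h =>
      ⟨ModularMixing.isFutureMixing_iff_isPastMixing.mpr h, h⟩
  refine ⟨ModularMixing.ket_mem_domain_modularPow ψ, hmix, ?_⟩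
  rcases hip with rfl | rfl
  · have hip : ∀ a b, ModularMixing.gnsInner ψ a b =
        inner ℂ (ModularMixing.ket ψ a) (ModularMixing.ket ψ b) := fun a b =>
      (ModularMixing.inner_ket ψ a b).symm
    refine ⟨ModularMixing.subset_generatedSystem hip hX_orthogonal,
      ModularMixing.isOperatorSystem_generatedSystem hip
        (ModularMixing.continuous_ket ψ hψ_state) hcl hX_orthogonal hX_selfAdjoint,
      ModularMixing.isMixing_generatedSystem hψ_state hip (c := ‖ModularMixing.ket ψ 1‖)
        (fun a => ?_) (fun b => ⟨_, norm_nonneg (ModularMixing.graphVector ψ b), fun a t => ?_⟩)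
        hmix⟩
    · rw [ModularMixing.apply_eq_inner_ket_one]
      exact norm_inner_le_norm _ _
    · rw [mul_comm]
      exact ModularMixing.norm_modularCorrelator_le ψ a b t
  · have hip := ModularMixing.alternateInner_eq_inner ψ
    refine ⟨ModularMixing.subset_generatedSystem hip hX_orthogonal,
      ModularMixing.isOperatorSystem_generatedSystem hip
        (ModularMixing.continuous_alternateKet ψ hψ_state) (fun w hw => ?_)
        hX_orthogonal hX_selfAdjoint,
      ModularMixing.isMixing_generatedSystem hψ_state hip
        (ModularMixing.norm_apply_le_alternateKet ψ)
        (fun b => ⟨_, norm_nonneg (ModularMixing.alternateKet ψ b), fun a t => ?_⟩) hmix⟩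
    -- The involution preserves the norm of `Δ ^ (1/4) |a⟩`; equality of norms survives the closure
    -- and gives closability.
    · have h : (0, w) ∈ {p : ψ.GNS × ψ.GNS | ‖p.2‖ = ‖p.1‖} := by
        refine closure_minimal ?_ (isClosed_eq (by fun_prop) (by fun_prop)) hw
        rintro _ ⟨a, rfl⟩
        exact ModularMixing.norm_alternateKet_star ψ hcl a
      simpa using h
    · rw [mul_comm]
      exact ModularMixing.norm_modularCorrelator_le_alternateKet ψ a b t
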